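/- Let $\alpha>\beta>\gamma>0$ and let $\mathcal E\subset\mathbb R^3$ be the ellipsoid $\frac{x^2}{\alpha}+\frac{y^2}{\beta}+\frac{z^2}{\gamma}=1$ (up to congruence, any ellipsoid with three distinct semi-axes). Write $T_p$ for the tangent plane of $\mathcal E$ at $p$ and $U\subset\mathcal E$ for the set of umbilic points (points where the two principal curvatures coincide). A \emph{circular cross section} of a surface is an intersection of it with a plane which is a circle of positive radius. (0) $U$ consists of four points and $U=-U$; for $u,v\in U$ the planes $T_u,T_v$ are parallel if and only if $v=\pm u$. (1) Let $u\in U$. Through every point of $\mathcal E$ passes exactly one plane parallel to $T_u$. Every plane parallel to $T_u$ that meets $\mathcal E$ intersects it in a circle, which degenerates to a point exactly for the planes $T_u$ and $T_{-u}$. Thus $\mathcal E$ is sliced into two one-parameter families of circles. Conversely, the plane of any circular cross section of $\mathcal E$ is parallel to $T_u$ for some $u\in U$. (2) Let $P$ be the plane of a circular cross section $C$ of $\mathcal E$. Then there is $u\in U$ with $P\parallel T_u$ such that the planes $T_x$, $x\in C$, have exactly one common point in projective space, and it lies on the line through $u$ and $-u$: if $0\notin P$, then $\bigcap_{x\in C}T_x=\{q\}$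 with $q$ on that line; if $0\in P$, the common point is the point at infinity of that line, i.e. the directions common to all $T_x$, $x\in C$, are exactly the direction of the line. (3) A \emph{net} on a surface is a pair of one-parameter families of curves foliating it, with exactly one curve of each family through each point. A net $\mathcal N_2$ is \emph{diagonal to} a net $\mathcal N_1$ if, for every quadrilateral whose sides lie on two curves of each family of $\mathcal N_1$, whenever a curve of $\mathcal N_2$ passes through one pair of opposite vertices, a curve of $\mathcal N_2$ also passes through the other pair. On $\mathcal E\setminus U$, the maximal lines of curvature (one family for the larger, one for the smaller principal curvature) form a net, and the circular cross sections (with umbilic points deleted) in the planes parallel to $T_u$ and to $T_v$, where $u,v\in U$, $v\ne\pm u$, form a net. Each of these two nets is diagonal to the other. (4) For $\lambda>-\gamma$ let $\mathcal E_\lambda$ be the confocal ellipsoid $\frac{x^2}{\alpha+\lambda}+\frac{y^2}{\beta+\lambda}+\frac{z^2}{\gamma+\lambda}=1$. There are linear maps $\Phi_\lambda:\mathbb R^3\to\mathbb R^3$, depending continuously on $\lambda\in(-\gamma,\infty)$, with $\Phi_0=\mathrm{id}$, such that for all $\lambda$: $\Phi_\lambda(\mathcal E)=\sqrt{\tfrac{\beta}{\beta+\lambda}}\;\mathcal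 E_\lambda$; the restriction of $\Phi_\lambda$ to every circular cross section of $\mathcal E$ preserves distances (so every deformed circle is congruent to the original one); and the images under $\Phi_\lambda$ of the circular cross sections of $\mathcal E$ are exactly the circular cross sections of $\Phi_\lambda(\mathcal E)$. Any two of the ellipsoids $\Phi_\lambda(\mathcal E)$ are confocal up to a scaling by a positive factor. -/

import Mathlib

open Set Filter Topology
open scoped Pointwise RealInnerProductSpace ContDiff

noncomputable section

/-- Euclidean three-space. -/
abbrev E3 : Type := EuclideanSpace ℝ (Fin 3)

/-! ### Geometry of an implicit surface `{F = 1}` (with nonvanishing gradient) -/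

/-- The tangent space at `p` of the level surface of `F` through `p`. -/
def tangentSpace (F : E3 → ℝ) (p : E3) : Submodule ℝ E3 :=
  (Submodule.span ℝ {gradient F p})ᗮ

/-- The tangent plane at `p` of the level surface of `F` through `p`. -/
def tangentPlane (F : E3 → ℝ) (p : E3) : AffineSubspace ℝ E3 :=
  AffineSubspace.mk' p (tangentSpace F p)

/-- The unit normal field (Gauss map) of the level surfaces of `F`. -/
def unitNormal (F : E3 → ℝ) (p : E3) : E3 :=
  ‖gradient F p‖⁻¹ • gradient F p

/-- The Weingarten map: derivative of the unit normal (to be applied to tangent vectors). -/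
def weingarten (F : E3 → ℝ) (p : E3) : E3 →L[ℝ] E3 :=
  fderiv ℝ (unitNormal F) p

/-- The umbilic points of the surface `{F = 1}`: the two principal curvatures coincide, that is,
the Weingarten map is a multiple of the identity on the tangent space. -/
def umbilics (F : E3 → ℝ) : Set E3 :=
  {p | F p = 1 ∧ ∃ k : ℝ, ∀ v ∈ tangentSpace F p, weingarten F p v = k • v}

/-- `v` spans a principal direction at `p` belonging to the larger principal curvature
(with respect to the unit normal `unitNormal F`). -/
def IsMaxPrincipal (F : E3 → ℝ) (p v : E3) : Prop :=
  v ≠ 0 ∧ v ∈ tangentSpace F p ∧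
    ∃ k : ℝ, weingarten F p v = k • v ∧
      ∀ w ∈ tangentSpace F p, ⟪weingarten F p w, w⟫ ≤ k * ‖w‖ ^ 2

/-- `v` spans a principal direction at `p` belonging to the smaller principal curvature
(with respect to the unit normal `unitNormal F`). -/
def IsMinPrincipal (F : E3 → ℝ) (p v : E3) : Prop :=
  v ≠ 0 ∧ v ∈ tangentSpace F p ∧
    ∃ k : ℝ, weingarten F p v = k • v ∧
      ∀ w ∈ tangentSpace F p, k * ‖w‖ ^ 2 ≤ ⟪weingarten F p w, w⟫

/-- The maximal integral curve through `p`, inside `S`, of a direction field `dir`: all points which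
lie together with `p` on a regular `C¹` curve in `S` whose velocity obeys `dir` everywhere. -/
def lineThrough (S : Set E3) (dir : E3 → E3 → Prop) (p : E3) : Set E3 :=
  {q | ∃ (a b : ℝ) (c : ℝ → E3), ContDiffOn ℝ 1 c (Ioo a b) ∧
    (∀ t ∈ Ioo a b, c t ∈ S ∧ dir (c t) (deriv c t)) ∧
    p ∈ c '' Ioo a b ∧ q ∈ c '' Ioo a b}

/-- The surface `{F = 1}` without its umbilic points; the lines of curvature form a net there. -/
def regularPart (F : E3 → ℝ) : Set E3 := {p | F p = 1} \ umbilics F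

/-- The two families of (maximal) lines of curvature of `{F = 1}`, off the umbilic points. -/
def curvatureNet (F : E3 → ℝ) : Set (Set E3) × Set (Set E3) :=
  (lineThrough (regularPart F) (IsMaxPrincipal F) '' regularPart F,
   lineThrough (regularPart F) (IsMinPrincipal F) '' regularPart F)

/-! ### Nets and the diagonal relation -/

/-- A family of curves on the part `S` of the surface `{F = 1}` that foliates `S`, with exactly one
curve through each point of `S`. Near each point `p` of `S` the curves are made up of the level
curves on `S` of a `C¹` function `f` whose differential at `p` does not vanish on the tangent space,
and the curve through `p` is there precisely the level curve of `f` through `p`. -/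
def Foliates (F : E3 → ℝ) (S : Set E3) (A : Set (Set E3)) : Prop :=
  (∀ C ∈ A, C.Nonempty ∧ C ⊆ S) ∧
  (∀ p ∈ S, ∃! C, C ∈ A ∧ p ∈ C) ∧
  (∀ p ∈ S, ∃ (W : Set E3) (f : E3 → ℝ), IsOpen W ∧ p ∈ W ∧ ContDiffOn ℝ 1 f W ∧
    (∃ v ∈ tangentSpace F p, fderiv ℝ f p v ≠ 0) ∧
    (∀ x ∈ S ∩ W, ∀ y ∈ S ∩ W, f x = f y → ∃ C ∈ A, x ∈ C ∧ y ∈ C) ∧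
    (∀ x ∈ S ∩ W, (∃ C ∈ A, x ∈ C ∧ p ∈ C) → f x = f p))

/-- A net on the part `S` of the surface `{F = 1}`. -/
def IsNet (F : E3 → ℝ) (S : Set E3) (N : Set (Set E3) × Set (Set E3)) : Prop :=
  Foliates F S N.1 ∧ Foliates F S N.2

/-- Some curve of (one of the two families of) the net `N` passes through both `p` and `q`. -/
def Joins (N : Set (Set E3) × Set (Set E3)) (p q : E3) : Prop :=
  ∃ C ∈ N.1 ∪ N.2, p ∈ C ∧ q ∈ C

/-- `N₂` is diagonal to `N₁`: whenever a curve of `N₂` passes through two opposite vertices `p, r` of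
a quadrilateral `p q r s` formed by four curves of `N₁`, then a curve of `N₂` also passes through the
two remaining vertices `q, s`. -/
def IsDiagonalTo (N₂ N₁ : Set (Set E3) × Set (Set E3)) : Prop :=
  ∀ A ∈ N₁.1, ∀ A' ∈ N₁.1, ∀ B ∈ N₁.2, ∀ B' ∈ N₁.2, A ≠ A' → B ≠ B' →
    ∀ p ∈ A ∩ B, ∀ q ∈ A' ∩ B, ∀ r ∈ A' ∩ B', ∀ s ∈ A ∩ B',
      Joins N₂ p r → Joins N₂ q s

/-! ### Ellipsoids and circular cross sections -/

/-- The quadratic form of the ellipsoid with squared semi-axes `α, β, γ`. -/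
def ellipsoidForm (α β γ : ℝ) (p : E3) : ℝ :=
  p 0 ^ 2 / α + p 1 ^ 2 / β + p 2 ^ 2 / γ

/-- The ellipsoid `x² / α + y² / β + z² / γ = 1`. -/
def ellipsoid (α β γ : ℝ) : Set E3 := {p | ellipsoidForm α β γ p = 1}

/-- The circle in the affine subspace `P` with centre `c` and radius `r`. -/
def circleIn (P : AffineSubspace ℝ E3) (c : E3) (r : ℝ) : Set E3 :=
  {x | x ∈ P ∧ dist x c = r}

/-- `P` is a plane which intersects `S` in a circle of positive radius. -/
def CutsCircle (S : Set E3) (P : AffineSubspace ℝ E3) : Prop :=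
  Module.finrank ℝ P.direction = 2 ∧ ∃ c ∈ P, ∃ r : ℝ, 0 < r ∧ S ∩ P = circleIn P c r

/-- All circular cross sections (of positive radius) of `S`. -/
def circularSections (S : Set E3) : Set (Set E3) :=
  {C | ∃ P : AffineSubspace ℝ E3, CutsCircle S P ∧ C = S ∩ P}

/-- The family of circular cross sections of `{F = 1}` in planes parallel to the tangent plane at
`u`, as curves on the surface without its umbilic points (some circles pass through umbilics). -/
def circleFamily (F : E3 → ℝ) (u : E3) : Set (Set E3) :=
  {C | ∃ P : AffineSubspace ℝ E3, P.Parallel (tangentPlane F u) ∧ CutsCircle {p | F p = 1} P ∧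
    C = ({p | F p = 1} ∩ P) \ umbilics F}

/-- Two ellipsoids (centred at the origin, axes along the coordinate axes, in decreasing order)
are confocal: their squared semi-axes differ by a common additive constant. -/
def AreConfocal (S T : Set E3) : Prop :=
  ∃ a b c l : ℝ, a > b ∧ b > c ∧ c > 0 ∧ c + l > 0 ∧
    S = ellipsoid a b c ∧ T = ellipsoid (a + l) (b + l) (c + l)

end

/-! Write `F` for the quadratic form of the ellipsoid and `L_u` for the linear form `⟪conormal α β γ
u, ·⟫`, whose level 1 is the tangent plane at `u`. The form `F - ‖·‖² / β` is indefinite of rank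
two, so it splits into two linear factors, proportional to the forms `L_u` of the two pairs of
opposite umbilics. Their kernels are the only planes through the origin on which `F` is a multiple
of the squared length (`umbilic_of_form_eq`, `exists_umbilic_of_form_eq`). At a point of the
ellipsoid, being umbilic says precisely that the tangent directions form such a plane
(`mem_umbilics_iff`).

The quantitative form of this is `IsUmbilicPoint.form_eq`: `F x = L_u(x)² + ‖x - L_u(x) u‖² / β`. It
shows that the section at level `L_u = d` is the circle with centre `d u` and squared radius `β (1 -
d²)`. The slicing follows at once. The common point of the tangent planes along this circle is the
pole `u / d` of its plane. A diagonal map between ellipsoids with the same `β` that carries umbilics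
to umbilics is isometric on the circles; scaling the confocal ellipsoids to a constant middle axis
produces such maps.

For the nets, the ellipsoid is the image of the unit sphere under `diag (√α, √β, √γ)`, and the
umbilics are the images of `(±k, 0, ±l)` with `k² + l² = 1` and `β = α l² + γ k²`. In the
sphero-conal parametrization `sphereParam`, put `A = arcsin (k cos θ)` and `B = arcsin (l cos φ)`.
Then `k x + l z = sin (A + B)` and `k x - l z = sin (A - B)` (`arcsin_sphereParam`), so the circles
are the curves `A ± B = const`. The coordinate directions are orthogonal and conjugate on the
ellipsoid, hence principal, so the lines of curvature are `A = const` and `B = const`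
(`principal_sphereParam_iff`, `CurveChart.mem_lineThrough_iff`). Diagonality is then the elementary
relation between the lines `A, B = const` and `A ± B = const` in the plane. What needs care is the
behaviour of the parametrization at the arcs between umbilics, where it is folded; `CurveChart`
handles this for both families at once. -/

noncomputable section

/-! ### Diagonal maps and coordinates -/

/-- The linear map `diag (a, b, c)` of Euclidean three-space. -/
def diagMap (a b c : ℝ) : E3 →L[ℝ] E3 :=
  a • (EuclideanSpace.proj 0 : E3 →L[ℝ] ℝ).smulRight (EuclideanSpace.single 0 1 : E3) +
    b • (EuclideanSpace.proj 1 : E3 →L[ℝ] ℝ).smulRight (EuclideanSpace.single 1 1 : E3) +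
    c • (EuclideanSpace.proj 2 : E3 →L[ℝ] ℝ).smulRight (EuclideanSpace.single 2 1 : E3)

@[simp] theorem diagMap_apply_zero (a b c : ℝ) (x : E3) : diagMap a b c x 0 = a * x 0 := by
  simp [diagMap]

@[simp] theorem diagMap_apply_one (a b c : ℝ) (x : E3) : diagMap a b c x 1 = b * x 1 := by
  simp [diagMap]

@[simp] theorem diagMap_apply_two (a b c : ℝ) (x : E3) : diagMap a b c x 2 = c * x 2 := by
  simp [diagMap]

theorem E3.ext {x y : E3} (h0 : x 0 = y 0) (h1 : x 1 = y 1) (h2 : x 2 = y 2) : x = y := by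
  ext i
  fin_cases i <;> assumption

theorem E3.inner_eq (x y : E3) : ⟪x, y⟫ = x 0 * y 0 + x 1 * y 1 + x 2 * y 2 := by
  simp only [PiLp.inner_apply, Fin.sum_univ_three, RCLike.inner_apply, conj_trivial]
  ring

theorem E3.norm_sq_eq (x : E3) : ‖x‖ ^ 2 = x 0 ^ 2 + x 1 ^ 2 + x 2 ^ 2 := by
  rw [EuclideanSpace.real_norm_sq_eq, Fin.sum_univ_three]

/-- Half the gradient of the quadratic form of the ellipsoid. -/
def conormal (α β γ : ℝ) : E3 →L[ℝ] E3 := diagMap α⁻¹ β⁻¹ γ⁻¹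

theorem inner_conormal (α β γ : ℝ) (x y : E3) :
    ⟪conormal α β γ x, y⟫ = x 0 * y 0 / α + x 1 * y 1 / β + x 2 * y 2 / γ := by
  rw [E3.inner_eq]
  simp only [conormal, diagMap_apply_zero, diagMap_apply_one, diagMap_apply_two]
  ring

theorem inner_conormal_comm (α β γ : ℝ) (x y : E3) :
    ⟪conormal α β γ x, y⟫ = ⟪conormal α β γ y, x⟫ := by
  rw [inner_conormal, inner_conormal]; ring

theorem ellipsoidForm_eq_inner (α β γ : ℝ) (x : E3) :
    ellipsoidForm α β γ x = ⟪conormal α β γ x, x⟫ := by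
  rw [inner_conormal, ellipsoidForm]; ring

theorem ellipsoidForm_add (α β γ : ℝ) (x y : E3) :
    ellipsoidForm α β γ (x + y) =
      ellipsoidForm α β γ x + 2 * ⟪conormal α β γ x, y⟫ + ellipsoidForm α β γ y := by
  simp only [inner_conormal, ellipsoidForm, PiLp.add_apply]; ring

theorem ellipsoidForm_smul (α β γ c : ℝ) (x : E3) :
    ellipsoidForm α β γ (c • x) = c ^ 2 * ellipsoidForm α β γ x := by
  simp only [ellipsoidForm, PiLp.smul_apply, smul_eq_mul]; ring

theorem ellipsoidForm_neg (α β γ : ℝ) (x : E3) :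
    ellipsoidForm α β γ (-x) = ellipsoidForm α β γ x := by
  simp [ellipsoidForm]

theorem hasGradientAt_ellipsoidForm (α β γ : ℝ) (p : E3) :
    HasGradientAt (ellipsoidForm α β γ) ((2 : ℝ) • conormal α β γ p) p := by
  rw [hasGradientAt_iff_hasFDerivAt]
  have h := (conormal α β γ).hasFDerivAt (x := p) |>.inner ℝ (hasFDerivAt_id p)
  have hF : ellipsoidForm α β γ = fun x => ⟪conormal α β γ x, id x⟫ :=
    funext fun x => ellipsoidForm_eq_inner α β γ x
  rw [hF]
  refine h.congr_fderiv ?_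
  ext v
  simp [inner_conormal_comm α β γ v p]
  ring

theorem gradient_ellipsoidForm (α β γ : ℝ) (p : E3) :
    gradient (ellipsoidForm α β γ) p = (2 : ℝ) • conormal α β γ p :=
  (hasGradientAt_ellipsoidForm α β γ p).gradient

theorem mem_tangentSpace {α β γ : ℝ} {p v : E3} :
    v ∈ tangentSpace (ellipsoidForm α β γ) p ↔ ⟪conormal α β γ p, v⟫ = 0 := by
  rw [tangentSpace, gradient_ellipsoidForm, Submodule.mem_orthogonal_singleton_iff_inner_right,
    inner_smul_left]
  simp

theorem mem_tangentPlane {α β γ : ℝ} {p x : E3} (hp : ellipsoidForm α β γ p = 1) :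
    x ∈ tangentPlane (ellipsoidForm α β γ) p ↔ ⟪conormal α β γ p, x⟫ = 1 := by
  rw [tangentPlane, AffineSubspace.mem_mk', mem_tangentSpace, vsub_eq_sub, inner_sub_right,
    ← ellipsoidForm_eq_inner, hp, sub_eq_zero]

theorem direction_tangentPlane (F : E3 → ℝ) (p : E3) :
    (tangentPlane F p).direction = tangentSpace F p :=
  AffineSubspace.direction_mk' _ _

theorem conormal_ne_zero {α β γ : ℝ} {p : E3} (hp : ellipsoidForm α β γ p = 1) :
    conormal α β γ p ≠ 0 := by
  intro h
  rw [ellipsoidForm_eq_inner, h, inner_zero_left] at hp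
  exact zero_ne_one hp

theorem finrank_tangentSpace {α β γ : ℝ} {p : E3} (hp : ellipsoidForm α β γ p = 1) :
    Module.finrank ℝ (tangentSpace (ellipsoidForm α β γ) p) = 2 := by
  have : Fact (Module.finrank ℝ E3 = 2 + 1) := ⟨by simp⟩
  rw [tangentSpace, gradient_ellipsoidForm]
  exact Submodule.finrank_orthogonal_span_singleton
    (smul_ne_zero two_ne_zero (conormal_ne_zero hp))

/-! ### The Weingarten map of the ellipsoid -/

theorem unitNormal_ellipsoidForm (α β γ : ℝ) :
    unitNormal (ellipsoidForm α β γ) =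
      fun p => ‖conormal α β γ p‖⁻¹ • conormal α β γ p := by
  funext p
  rw [unitNormal, gradient_ellipsoidForm, norm_smul, smul_smul]
  congr 1
  simp [mul_comm]

/-- The unit normal has constant length, so its derivative is tangent. In the derivative of `‖N‖⁻¹ •
N` the term from the scalar factor is a multiple of the normal and disappears against tangent
vectors. Pairings with tangent vectors determine the map, so no closed formula is needed. -/
theorem weingarten_ellipsoidForm {α β γ : ℝ} {p : E3} (hp : ellipsoidForm α β γ p = 1) (v : E3) :
    weingarten (ellipsoidForm α β γ) p v ∈ tangentSpace (ellipsoidForm α β γ) p ∧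
      ∀ w ∈ tangentSpace (ellipsoidForm α β γ) p,
        ⟪weingarten (ellipsoidForm α β γ) p v, w⟫ =
          ‖conormal α β γ p‖⁻¹ * ⟪conormal α β γ v, w⟫ := by
  have hn : conormal α β γ p ≠ 0 := conormal_ne_zero hp
  have hn' : ‖conormal α β γ p‖ ≠ 0 := norm_ne_zero_iff.2 hn
  have hd : DifferentiableAt ℝ (fun x => ‖conormal α β γ x‖⁻¹) p :=
    ((conormal α β γ).differentiableAt.norm ℝ hn).inv hn'
  have hN := hd.hasFDerivAt.smul ((conormal α β γ).hasFDerivAt (x := p))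
  have hN' : HasFDerivAt (unitNormal (ellipsoidForm α β γ))
      (weingarten (ellipsoidForm α β γ) p) p := by
    have : DifferentiableAt ℝ (unitNormal (ellipsoidForm α β γ)) p := by
      rw [unitNormal_ellipsoidForm]; exact hN.differentiableAt
    exact this.hasFDerivAt
  have hN'' := hN'
  rw [unitNormal_ellipsoidForm] at hN''
  have hW := hN''.unique hN
  constructor
  · rw [mem_tangentSpace]
    have h1 := hN'.inner ℝ hN'
    have h2 : (fun x => ⟪unitNormal (ellipsoidForm α β γ) x,
        unitNormal (ellipsoidForm α β γ) x⟫) =ᶠ[𝓝 p] fun _ => (1 : ℝ) := by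
      have : ∀ᶠ x in 𝓝 p, conormal α β γ x ≠ 0 :=
        (conormal α β γ).continuous.continuousAt.eventually_ne hn
      filter_upwards [this] with x hx
      have hx' : ‖conormal α β γ x‖ ≠ 0 := norm_ne_zero_iff.2 hx
      simp only [unitNormal_ellipsoidForm]
      rw [real_inner_self_eq_norm_sq, norm_smul, norm_inv, norm_norm, inv_mul_cancel₀ hx', one_pow]
    have h3 := (h1.congr_of_eventuallyEq h2.symm).unique (hasFDerivAt_const (1 : ℝ) p)
    have h4 := congrArg (fun g : E3 →L[ℝ] ℝ => g v) h3
    simp only [unitNormal_ellipsoidForm, ContinuousLinearMap.comp_apply, fderivInnerCLM_apply,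
      ContinuousLinearMap.prod_apply, inner_smul_left, inner_smul_right] at h4
    rw [real_inner_comm (conormal α β γ p)] at h4
    simp at h4
    exact h4.resolve_left hn
  · intro w hw
    rw [mem_tangentSpace] at hw
    rw [hW]
    simp [inner_add_left, inner_smul_left, hw]

/-! ### Umbilic points -/

/-- If a diagonal quadratic form with increasing coefficients vanishes on the plane orthogonal to
`(n₀, n₁, n₂) ≠ 0`, then this plane contains the middle axis and is determined up to reflection. -/
theorem normal_of_diagonal_form_eq_zero {A B C n₀ n₁ n₂ : ℝ} (hAB : A < B) (hBC : B < C)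
    (hn : n₀ ≠ 0 ∨ n₁ ≠ 0 ∨ n₂ ≠ 0)
    (h : ∀ x y z : ℝ, n₀ * x + n₁ * y + n₂ * z = 0 → A * x ^ 2 + B * y ^ 2 + C * z ^ 2 = 0) :
    n₁ = 0 ∧ B = 0 ∧ A * n₂ ^ 2 + C * n₀ ^ 2 = 0 := by
  -- The test vectors are the cross products of the normal with the coordinate axes, up to sign, and
  -- their pairwise sums; polarization then yields the mixed products `e12`, `e13`, `e23`.
  have h1 := h 0 n₂ (-n₁) (by ring)
  have h2 := h (-n₂) 0 n₀ (by ring)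
  have h3 := h n₁ (-n₀) 0 (by ring)
  have h12 := h (-n₂) n₂ (n₀ - n₁) (by ring)
  have h13 := h n₁ (n₂ - n₀) (-n₁) (by ring)
  have h23 := h (n₁ - n₂) (-n₀) n₀ (by ring)
  have e12 : C * (n₀ * n₁) = 0 := by linear_combination (h1 + h2 - h12) / 2
  have e13 : B * (n₂ * n₀) = 0 := by linear_combination (h1 + h3 - h13) / 2
  have e23 : A * (n₁ * n₂) = 0 := by linear_combination (h2 + h3 - h23) / 2
  have hn1 : n₁ = 0 := by
    by_contra hn1
    have q1 : 0 < n₁ ^ 2 := by positivity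
    by_cases hn0 : n₀ = 0
    · subst hn0
      have hA : A = 0 := by
        have : A * n₁ ^ 2 = 0 := by linear_combination h3
        exact (mul_eq_zero.1 this).resolve_right q1.ne'
      nlinarith [sq_nonneg n₂, mul_nonneg (by linarith : (0:ℝ) ≤ B) (sq_nonneg n₂),
        mul_pos (by linarith : (0:ℝ) < C) q1]
    · have hC : C = 0 := (mul_eq_zero.1 e12).resolve_right (mul_ne_zero hn0 hn1)
      have q0 : 0 < n₀ ^ 2 := by positivity
      nlinarith [mul_pos (by linarith : (0:ℝ) < -A) q1, mul_pos (by linarith : (0:ℝ) < -B) q0]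
  subst hn1
  have hB : B = 0 := by
    by_contra hB
    have hz : n₂ = 0 := by
      have : B * n₂ ^ 2 = 0 := by linear_combination h1
      simpa [hB] using this
    have hx : n₀ = 0 := by
      have : B * n₀ ^ 2 = 0 := by linear_combination h3
      simpa [hB] using this
    simp [hz, hx] at hn
  exact ⟨rfl, hB, by linear_combination h2⟩

/-- The umbilic conditions on a point of the ellipsoid, in coordinates. -/
def IsUmbilicPoint (α β γ : ℝ) (p : E3) : Prop :=
  p 1 = 0 ∧ p 0 ^ 2 = α * (α - β) / (α - γ) ∧ p 2 ^ 2 = γ * (β - γ) / (α - γ)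

theorem IsUmbilicPoint.neg {α β γ : ℝ} {p : E3} (h : IsUmbilicPoint α β γ p) :
    IsUmbilicPoint α β γ (-p) := by
  simpa [IsUmbilicPoint] using h

section Ordered

variable {α β γ : ℝ} (hαβ : α > β) (hβγ : β > γ) (hγ : γ > 0)
include hαβ hβγ hγ

/-- The form `F - κ ‖·‖²` is diagonal with increasing coefficients and vanishes on the plane, so its
middle coefficient must be zero, which forces `κ = 1 / β`. -/
theorem umbilic_of_form_eq {n : E3} (hn : n ≠ 0) {κ : ℝ}
    (h : ∀ v, ⟪n, v⟫ = 0 → ellipsoidForm α β γ v = κ * ‖v‖ ^ 2) :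
    n 1 = 0 ∧ (1 / α - 1 / β) * n 2 ^ 2 + (1 / γ - 1 / β) * n 0 ^ 2 = 0 := by
  have hβ : 0 < β := hγ.trans hβγ
  have h1 : 1 / α < 1 / β := one_div_lt_one_div_of_lt hβ hαβ
  have h2 : 1 / β < 1 / γ := one_div_lt_one_div_of_lt hγ hβγ
  have hn' : n 0 ≠ 0 ∨ n 1 ≠ 0 ∨ n 2 ≠ 0 := by
    by_contra! hc
    exact hn (E3.ext hc.1 hc.2.1 hc.2.2)
  obtain ⟨e1, e2, e3⟩ := normal_of_diagonal_form_eq_zero (A := 1 / α - κ) (B := 1 / β - κ)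
    (C := 1 / γ - κ) (by linarith) (by linarith) hn' (by
      intro x y z hxyz
      have := h !₂[x, y, z] (by simpa [E3.inner_eq] using hxyz)
      rw [E3.norm_sq_eq] at this
      simp [ellipsoidForm] at this
      linear_combination this)
  refine ⟨e1, ?_⟩
  have : κ = 1 / β := by linarith
  rw [← this]
  exact e3

theorem IsUmbilicPoint.ellipsoidForm {u : E3} (hu : IsUmbilicPoint α β γ u) :
    ellipsoidForm α β γ u = 1 := by
  obtain ⟨h1, h0, h2⟩ := hu
  have hβ : 0 < β := hγ.trans hβγ
  have hα : 0 < α := hβ.trans hαβ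
  have h4 : α - γ ≠ 0 := by linarith
  rw [_root_.ellipsoidForm, h1, h0, h2]
  field_simp
  ring

/-- The quadratic form of the ellipsoid is the sum of the square of a linear form and a multiple
of the squared distance from a diameter through umbilic points. -/
theorem IsUmbilicPoint.form_eq {u : E3} (hu : IsUmbilicPoint α β γ u) (x : E3) :
    _root_.ellipsoidForm α β γ x =
      ⟪conormal α β γ u, x⟫ ^ 2 + ‖x - ⟪conormal α β γ u, x⟫ • u‖ ^ 2 / β := by
  obtain ⟨h1, h0, h2⟩ := hu
  have hβ : 0 < β := hγ.trans hβγ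
  have hα : 0 < α := hβ.trans hαβ
  have h4 : α - γ ≠ 0 := by linarith
  have k0 : u 0 ^ 2 * (α - γ) = α * (α - β) := by rw [h0]; field_simp
  have k2 : u 2 ^ 2 * (α - γ) = γ * (β - γ) := by rw [h2]; field_simp
  rw [E3.norm_sq_eq, inner_conormal, _root_.ellipsoidForm]
  simp only [PiLp.sub_apply, PiLp.smul_apply, smul_eq_mul, h1]
  generalize u 0 = a at *
  generalize u 2 = c at *
  -- Equivalently `‖u‖² = α + γ - β`; this value is what cancels the mixed terms in `x 0 * x 2`.
  have hs : β + a ^ 2 + c ^ 2 = α + γ := by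
    have : (β + a ^ 2 + c ^ 2) * (α - γ) = (α + γ) * (α - γ) := by linear_combination k0 + k2
    exact mul_right_cancel₀ h4 this
  obtain ⟨L, hL⟩ : ∃ L, L = x 0 * a / α + x 2 * c / γ := ⟨_, rfl⟩
  have e : a * x 0 / α + 0 * x 1 / β + c * x 2 / γ = L := by rw [hL]; ring
  rw [e]
  have e2 : β * x 0 ^ 2 / α + β * x 2 ^ 2 / γ =
      L ^ 2 * (β + a ^ 2 + c ^ 2) + x 0 ^ 2 + x 2 ^ 2 - 2 * L * (a * x 0 + c * x 2) := by
    rw [hs]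
    have ha : a ^ 2 = α * (α - β) / (α - γ) := h0
    have hc : c ^ 2 = γ * (β - γ) / (α - γ) := h2
    have e3 : L ^ 2 * (α + γ) + x 0 ^ 2 + x 2 ^ 2 - 2 * L * (a * x 0 + c * x 2) =
      a ^ 2 * x 0 ^ 2 * ((α + γ) / α ^ 2 - 2 / α) + c ^ 2 * x 2 ^ 2 * ((α + γ) / γ ^ 2 - 2 / γ)
        + x 0 ^ 2 + x 2 ^ 2 := by
      rw [hL]; field_simp; ring
    rw [e3, ha, hc]
    field_simp
    ring
  have e4 : x 0 ^ 2 / α + x 1 ^ 2 / β + x 2 ^ 2 / γ =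
    (β * x 0 ^ 2 / α + β * x 2 ^ 2 / γ + x 1 ^ 2) / β := by field_simp; ring
  rw [e4, e2]
  field_simp
  ring

theorem IsUmbilicPoint.form_eq_of_tangent {u v : E3} (hu : IsUmbilicPoint α β γ u)
    (hv : ⟪conormal α β γ u, v⟫ = 0) : _root_.ellipsoidForm α β γ v = ‖v‖ ^ 2 / β := by
  simpa [hv] using hu.form_eq hαβ hβγ hγ v

/-- Planes on which the quadratic form is a multiple of the Euclidean one are parallel to the
tangent plane at an umbilic point. -/
theorem exists_umbilic_of_form_eq {n : E3} (hn : n ≠ 0) {κ : ℝ}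
    (h : ∀ v, ⟪n, v⟫ = 0 → ellipsoidForm α β γ v = κ * ‖v‖ ^ 2) :
    ∃ (u : E3) (t : ℝ), IsUmbilicPoint α β γ u ∧ t ≠ 0 ∧ conormal α β γ u = t • n := by
  obtain ⟨h1, h2⟩ := umbilic_of_form_eq hαβ hβγ hγ hn h
  have hβ : 0 < β := hγ.trans hβγ
  have hα : 0 < α := hβ.trans hαβ
  have h4 : 0 < α - γ := by linarith
  have h5 : 0 < α - β := by linarith
  have h6 : 0 < β - γ := by linarith
  have h7 : n 2 ^ 2 * (γ * (α - β)) = n 0 ^ 2 * (α * (β - γ)) := by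
    field_simp at h2
    linear_combination -h2
  have hn0 : n 0 ≠ 0 := by
    intro h0
    rw [h0] at h7
    have : n 2 = 0 := by
      have h8 : n 2 ^ 2 * (γ * (α - β)) = 0 := by rw [h7]; ring
      have h9 : γ * (α - β) ≠ 0 := by positivity
      simpa [h9] using h8
    exact hn (E3.ext h0 h1 this)
  have hq : 0 < (α - β) / (α * (α - γ)) := by positivity
  -- The condition `conormal u = t • n` forces `u = diag (α, β, γ) (t n)`, and `t` is chosen to give
  -- `u 0 ^ 2` its prescribed value.
  refine ⟨diagMap α β γ ((√((α - β) / (α * (α - γ))) / n 0) • n),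
    √((α - β) / (α * (α - γ))) / n 0, ⟨?_, ?_, ?_⟩, ?_, ?_⟩
  · simp [h1]
  · simp only [diagMap_apply_zero, PiLp.smul_apply, smul_eq_mul]
    rw [div_mul_cancel₀ _ hn0, mul_pow, Real.sq_sqrt hq.le]
    field_simp
  · simp only [diagMap_apply_two, PiLp.smul_apply, smul_eq_mul]
    rw [mul_pow, mul_pow, div_pow, Real.sq_sqrt hq.le]
    field_simp
    linear_combination h7
  · exact div_ne_zero (Real.sqrt_pos.2 hq).ne' hn0
  · apply E3.ext <;>
      simp [conormal, hα.ne', hβ.ne', hγ.ne']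

/-- By `weingarten_ellipsoidForm` the second fundamental form is `F` on the tangent plane, up to the
factor `‖conormal p‖⁻¹`. Hence the point is umbilic exactly when `F` is there a multiple of the
squared length. -/
theorem mem_umbilics_iff {p : E3} :
    p ∈ umbilics (ellipsoidForm α β γ) ↔ IsUmbilicPoint α β γ p := by
  have hβ : 0 < β := hγ.trans hβγ
  have hα : 0 < α := hβ.trans hαβ
  have h4 : 0 < α - γ := by linarith
  constructor
  · rintro ⟨hp, k, hk⟩
    have hn := conormal_ne_zero hp
    have hn' : ‖conormal α β γ p‖ ≠ 0 := norm_ne_zero_iff.2 hn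
    obtain ⟨h1, h2⟩ := umbilic_of_form_eq hαβ hβγ hγ hn (κ := ‖conormal α β γ p‖ * k) (by
      intro v hv
      have hv' := mem_tangentSpace.2 hv
      have := (weingarten_ellipsoidForm hp v).2 v hv'
      rw [hk v hv', ← ellipsoidForm_eq_inner, inner_smul_left, real_inner_self_eq_norm_sq] at this
      simp only [conj_trivial] at this
      rw [mul_assoc, this, mul_inv_cancel_left₀ hn'])
    simp only [conormal, diagMap_apply_zero, diagMap_apply_one, diagMap_apply_two] at h1 h2
    have h1' : p 1 = 0 := by simpa [hβ.ne'] using h1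
    rw [ellipsoidForm, h1'] at hp
    field_simp at h2 hp
    have hp' : γ * p 0 ^ 2 + α * p 2 ^ 2 = α * γ :=
      mul_left_cancel₀ hβ.ne' (by linear_combination hp)
    have h2' : (α - β) * α * p 2 ^ 2 = (β - γ) * γ * p 0 ^ 2 := by linear_combination -h2
    refine ⟨h1', ?_, ?_⟩
    · rw [eq_div_iff h4.ne']
      apply mul_right_cancel₀ hγ.ne'
      linear_combination (α - β) * hp' - h2'
    · rw [eq_div_iff h4.ne']
      apply mul_right_cancel₀ hα.ne'
      linear_combination (β - γ) * hp' + h2'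
  · intro hu
    have hp := hu.ellipsoidForm hαβ hβγ hγ
    refine ⟨hp, ‖conormal α β γ p‖⁻¹ / β, fun v hv => ?_⟩
    obtain ⟨hW, hW2⟩ := weingarten_ellipsoidForm hp v
    -- The defect `w` is itself tangent, so it suffices that it is orthogonal to itself; polarizing
    -- `F = ‖·‖² / β` on the tangent plane gives this.
    rw [← sub_eq_zero, ← inner_self_eq_zero (𝕜 := ℝ)]
    have hmem := Submodule.sub_mem _ hW (Submodule.smul_mem _ (‖conormal α β γ p‖⁻¹ / β) hv)
    set w := weingarten (ellipsoidForm α β γ) p v - (‖conormal α β γ p‖⁻¹ / β) • v with hw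
    have key : ⟪conormal α β γ v, w⟫ = ⟪v, w⟫ / β := by
      have e1 := hu.form_eq_of_tangent hαβ hβγ hγ (mem_tangentSpace.1 hv)
      have e2 := hu.form_eq_of_tangent hαβ hβγ hγ (mem_tangentSpace.1 hmem)
      have e3 := hu.form_eq_of_tangent hαβ hβγ hγ
        (mem_tangentSpace.1 (Submodule.add_mem _ hv hmem))
      rw [ellipsoidForm_add, e1, e2, norm_add_sq_real] at e3
      linear_combination e3 / 2
    nth_rewrite 1 [hw]
    rw [inner_sub_left, hW2 w hmem, key, inner_smul_left]
    simp only [conj_trivial]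
    ring

end Ordered

/-! ### Planes parallel to the tangent plane at an umbilic point -/

theorem parallel_tangentPlane_iff {α β γ : ℝ} {u : E3} (hu : ellipsoidForm α β γ u = 1)
    {P : AffineSubspace ℝ E3} :
    P.Parallel (tangentPlane (ellipsoidForm α β γ) u) ↔
      ∃ d : ℝ, ∀ x, x ∈ P ↔ ⟪conormal α β γ u, x⟫ = d := by
  have hT : tangentPlane (ellipsoidForm α β γ) u ≠ ⊥ := by
    intro h
    have : u ∈ tangentPlane (ellipsoidForm α β γ) u := AffineSubspace.self_mem_mk' _ _
    rw [h] at this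
    exact AffineSubspace.notMem_bot ℝ E3 u this
  rw [AffineSubspace.parallel_iff_direction_eq_and_eq_bot_iff_eq_bot, direction_tangentPlane]
  simp only [hT, iff_false]
  constructor
  · rintro ⟨hd, hP⟩
    obtain ⟨p, hp⟩ := (AffineSubspace.nonempty_iff_ne_bot P).2 hP
    refine ⟨⟪conormal α β γ u, p⟫, fun x => ?_⟩
    rw [← AffineSubspace.vsub_right_mem_direction_iff_mem hp, hd, mem_tangentSpace, vsub_eq_sub,
      inner_sub_right, sub_eq_zero]
  · rintro ⟨d, hd⟩
    have hmem : d • u ∈ P := by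
      rw [hd, inner_smul_right, ← ellipsoidForm_eq_inner, hu, mul_one]
    refine ⟨?_, fun h => ?_⟩
    · ext v
      rw [← AffineSubspace.vadd_mem_iff_mem_direction v hmem, hd, mem_tangentSpace, vadd_eq_add,
        inner_add_right, (hd _).1 hmem, add_eq_right]
    · rw [h] at hmem
      exact AffineSubspace.notMem_bot ℝ E3 _ hmem

theorem direction_of_mem_iff {α β γ : ℝ} {u : E3} (hu : ellipsoidForm α β γ u = 1)
    {P : AffineSubspace ℝ E3} {d : ℝ} (hP : ∀ x, x ∈ P ↔ ⟪conormal α β γ u, x⟫ = d) :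
    P.direction = tangentSpace (ellipsoidForm α β γ) u := by
  rw [← direction_tangentPlane]
  exact ((parallel_tangentPlane_iff hu).2 ⟨d, hP⟩).direction_eq

/-- The plane on which the linear form `⟪conormal u, ·⟫` has the value `d`. -/
theorem exists_plane {α β γ : ℝ} {u : E3} (hu : ellipsoidForm α β γ u = 1) (d : ℝ) :
    ∃ P : AffineSubspace ℝ E3, ∀ x, x ∈ P ↔ ⟪conormal α β γ u, x⟫ = d := by
  refine ⟨AffineSubspace.mk' (d • u) (tangentSpace (ellipsoidForm α β γ) u), fun x => ?_⟩
  rw [AffineSubspace.mem_mk', mem_tangentSpace, vsub_eq_sub, inner_sub_right, inner_smul_right,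
    ← ellipsoidForm_eq_inner, hu, mul_one, sub_eq_zero]

theorem exists_norm_eq_one_of_finrank {V : Submodule ℝ E3} (hV : Module.finrank ℝ V = 2) :
    ∃ v ∈ V, ‖v‖ = 1 := by
  have : Nontrivial V := Module.nontrivial_of_finrank_pos (R := ℝ) (by omega)
  obtain ⟨v, hv⟩ := exists_ne (0 : V)
  have hv' : ‖(v : E3)‖ ≠ 0 := by simpa using hv
  exact ⟨‖(v : E3)‖⁻¹ • (v : E3), V.smul_mem _ v.2, by
    rw [norm_smul, norm_inv, norm_norm, inv_mul_cancel₀ hv']⟩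

theorem exists_normal_of_finrank {V : Submodule ℝ E3} (hV : Module.finrank ℝ V = 2) :
    ∃ n : E3, n ≠ 0 ∧ ∀ v, v ∈ V ↔ ⟪n, v⟫ = 0 := by
  have h1 : Module.finrank ℝ Vᗮ = 1 := by
    have := V.finrank_add_finrank_orthogonal
    rw [hV] at this
    simp at this
    omega
  obtain ⟨n, hn, hs⟩ := finrank_eq_one_iff'.1 h1
  refine ⟨n, by simpa using hn, fun v => ?_⟩
  have hVV : v ∈ V ↔ v ∈ Vᗮᗮ := by rw [V.orthogonal_orthogonal]
  rw [hVV, Submodule.mem_orthogonal]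
  constructor
  · exact fun h => h n n.2
  · intro h w hw
    obtain ⟨c, hc⟩ := hs ⟨w, hw⟩
    have : w = c • (n : E3) := by rw [← Submodule.coe_smul, hc]
    rw [this, inner_smul_left, h, mul_zero]

section Ordered

variable {α β γ : ℝ} (hαβ : α > β) (hβγ : β > γ) (hγ : γ > 0)
include hαβ hβγ hγ

/-- A rearrangement of `IsUmbilicPoint.form_eq`, from which centres, radii and the degenerate levels
`±1` of all sections are read off. -/
theorem IsUmbilicPoint.dist_sq {u : E3} (hu : IsUmbilicPoint α β γ u) {x : E3} :
    x ∈ ellipsoid α β γ ↔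
      dist x (⟪conormal α β γ u, x⟫ • u) ^ 2 = β * (1 - ⟪conormal α β γ u, x⟫ ^ 2) := by
  have hβ : 0 < β := hγ.trans hβγ
  rw [ellipsoid, mem_ofPred_eq, hu.form_eq hαβ hβγ hγ, dist_eq_norm]
  constructor <;> intro h
  · field_simp at h
    linarith
  · rw [h]; field_simp; ring

theorem IsUmbilicPoint.inner_sq_le {u : E3} (hu : IsUmbilicPoint α β γ u) {x : E3}
    (hx : x ∈ ellipsoid α β γ) : ⟪conormal α β γ u, x⟫ ^ 2 ≤ 1 := by
  have hβ : 0 < β := hγ.trans hβγ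
  have h := (hu.dist_sq hαβ hβγ hγ).1 hx
  have h2 : 0 ≤ β * (1 - ⟪conormal α β γ u, x⟫ ^ 2) := h ▸ sq_nonneg _
  linarith [nonneg_of_mul_nonneg_right h2 hβ]

theorem IsUmbilicPoint.eq_or_eq_neg {u : E3} (hu : IsUmbilicPoint α β γ u) {x : E3}
    (hx : x ∈ ellipsoid α β γ) (h : ⟪conormal α β γ u, x⟫ ^ 2 = 1) : x = u ∨ x = -u := by
  have h1 := (hu.dist_sq hαβ hβγ hγ).1 hx
  rw [h, sub_self, mul_zero, sq_eq_zero_iff, dist_eq_zero] at h1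
  rcases sq_eq_one_iff.1 h with h2 | h2
  · left; rw [h1, h2, one_smul]
  · right; rw [h1, h2, neg_one_smul]

theorem IsUmbilicPoint.inner_sq_lt {u : E3} (hu : IsUmbilicPoint α β γ u) {x : E3}
    (hx : x ∈ regularPart (_root_.ellipsoidForm α β γ)) : ⟪conormal α β γ u, x⟫ ^ 2 < 1 := by
  refine lt_of_le_of_ne (hu.inner_sq_le hαβ hβγ hγ hx.1) fun h => hx.2 ?_
  rw [mem_umbilics_iff hαβ hβγ hγ]
  rcases hu.eq_or_eq_neg hαβ hβγ hγ hx.1 h with rfl | rfl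
  exacts [hu, hu.neg]

theorem IsUmbilicPoint.section_eq {u : E3} (hu : IsUmbilicPoint α β γ u)
    {P : AffineSubspace ℝ E3} {d : ℝ} (hP : ∀ x, x ∈ P ↔ ⟪conormal α β γ u, x⟫ = d)
    (hd : d ^ 2 ≤ 1) :
    ellipsoid α β γ ∩ P = circleIn P (d • u) √(β * (1 - d ^ 2)) := by
  have hβ : 0 < β := hγ.trans hβγ
  have h0 : 0 ≤ β * (1 - d ^ 2) := mul_nonneg hβ.le (by linarith)
  ext x
  rw [circleIn, mem_inter_iff, mem_ofPred_eq, SetLike.mem_coe, and_comm]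
  refine and_congr_right fun hx => ?_
  rw [hu.dist_sq hαβ hβγ hγ, (hP x).1 hx, eq_comm (b := √_),
    Real.sqrt_eq_iff_mul_self_eq h0 dist_nonneg, sq, eq_comm]

theorem IsUmbilicPoint.smul_mem {u : E3} (hu : IsUmbilicPoint α β γ u)
    {P : AffineSubspace ℝ E3} {d : ℝ} (hP : ∀ x, x ∈ P ↔ ⟪conormal α β γ u, x⟫ = d) :
    d • u ∈ P := by
  rw [hP, inner_smul_right, ← ellipsoidForm_eq_inner, hu.ellipsoidForm hαβ hβγ hγ, mul_one]

theorem IsUmbilicPoint.cutsCircle {u : E3} (hu : IsUmbilicPoint α β γ u)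
    {P : AffineSubspace ℝ E3} {d : ℝ} (hP : ∀ x, x ∈ P ↔ ⟪conormal α β γ u, x⟫ = d)
    (hd : d ^ 2 < 1) : CutsCircle (ellipsoid α β γ) P := by
  have hβ : 0 < β := hγ.trans hβγ
  have hF := hu.ellipsoidForm hαβ hβγ hγ
  refine ⟨?_, d • u, hu.smul_mem hαβ hβγ hγ hP, √(β * (1 - d ^ 2)),
    Real.sqrt_pos.2 (mul_pos hβ (by linarith)), hu.section_eq hαβ hβγ hγ hP hd.le⟩
  rw [direction_of_mem_iff hF hP, finrank_tangentSpace hF]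

/-- The planes of the circular cross sections of the ellipsoid. -/
theorem _root_.CutsCircle.exists_umbilic {P : AffineSubspace ℝ E3}
    (h : CutsCircle (ellipsoid α β γ) P) :
    ∃ (u : E3) (d : ℝ), IsUmbilicPoint α β γ u ∧ d ^ 2 < 1 ∧
      ∀ x, x ∈ P ↔ ⟪conormal α β γ u, x⟫ = d := by
  obtain ⟨hfin, c, hc, r, hr, hS⟩ := h
  have hmem : ∀ v ∈ P.direction, ‖v‖ = 1 → ellipsoidForm α β γ (c + r • v) = 1 := by
    intro v hv hv1
    have : c + r • v ∈ circleIn P c r := by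
      refine ⟨?_, ?_⟩
      · rw [add_comm]
        exact AffineSubspace.vadd_mem_of_mem_direction (P.direction.smul_mem r hv) hc
      · rw [dist_eq_norm, add_sub_cancel_left, norm_smul, hv1, mul_one, Real.norm_of_nonneg hr.le]
    rw [← hS] at this
    exact this.1
  -- Adding the equations of the opposite points `c ± r v` eliminates the linear term, so `F` is
  -- constant on unit vectors of the plane's direction.
  have hform : ∀ v ∈ P.direction, ‖v‖ = 1 →
      ellipsoidForm α β γ v = (1 - ellipsoidForm α β γ c) / r ^ 2 := by
    intro v hv hv1
    have h1 := hmem v hv hv1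
    have h2 := hmem (-v) (neg_mem hv) (by rw [norm_neg, hv1])
    rw [ellipsoidForm_add, ellipsoidForm_smul, inner_smul_right] at h1 h2
    rw [ellipsoidForm_neg, inner_neg_right] at h2
    rw [eq_div_iff (by positivity)]
    linarith
  obtain ⟨n, hn, hV⟩ := exists_normal_of_finrank hfin
  obtain ⟨u, t, hu, ht, hut⟩ := exists_umbilic_of_form_eq hαβ hβγ hγ hn
    (κ := (1 - ellipsoidForm α β γ c) / r ^ 2) (by
      intro v hv
      by_cases hv0 : v = 0
      · simp [hv0, ellipsoidForm]
      have hv' : ‖v‖ ≠ 0 := norm_ne_zero_iff.2 hv0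
      have := hform (‖v‖⁻¹ • v) (P.direction.smul_mem _ ((hV v).2 hv)) (by
        rw [norm_smul, norm_inv, norm_norm, inv_mul_cancel₀ hv'])
      rw [ellipsoidForm_smul] at this
      rw [← this]
      field_simp)
  have hP : ∀ x, x ∈ P ↔ ⟪conormal α β γ u, x⟫ = ⟪conormal α β γ u, c⟫ := by
    intro x
    rw [← AffineSubspace.vsub_right_mem_direction_iff_mem hc, hV, vsub_eq_sub, hut,
      inner_smul_left, inner_smul_left, inner_sub_right]
    simp [ht, sub_eq_zero]
  refine ⟨u, ⟪conormal α β γ u, c⟫, hu, ?_, hP⟩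
  obtain ⟨v, hv, hv1⟩ := exists_norm_eq_one_of_finrank hfin
  have h1 := hmem v hv hv1
  have h2 := hmem (-v) (neg_mem hv) (by rw [norm_neg, hv1])
  have hv2 : ⟪conormal α β γ u, v⟫ = 0 := by
    rw [hut, inner_smul_left, (hV v).1 hv, mul_zero]
  have e1 : ⟪conormal α β γ u, c + r • v⟫ = ⟪conormal α β γ u, c⟫ := by
    rw [inner_add_right, inner_smul_right, hv2, mul_zero, add_zero]
  have e2 : ⟪conormal α β γ u, c + r • -v⟫ = ⟪conormal α β γ u, c⟫ := by
    rw [inner_add_right, inner_smul_right, inner_neg_right, hv2, neg_zero, mul_zero, add_zero]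
  -- At level `±1` the section would be the single point `d u`, whereas the circle contains the two
  -- distinct points `c ± r v`.
  refine lt_of_le_of_ne (e1 ▸ hu.inner_sq_le hαβ hβγ hγ h1) fun hd => ?_
  have d1 := (hu.dist_sq hαβ hβγ hγ).1 h1
  have d2 := (hu.dist_sq hαβ hβγ hγ).1 h2
  rw [e1, hd, sub_self, mul_zero, sq_eq_zero_iff, dist_eq_zero] at d1
  rw [e2, hd, sub_self, mul_zero, sq_eq_zero_iff, dist_eq_zero, ← d1] at d2
  have h3 : (2 * r) • v = 0 := by
    have := sub_eq_zero.2 d2.symm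
    rw [← this]
    module
  have h4 := congrArg norm h3
  rw [norm_smul, hv1, norm_zero, mul_one, Real.norm_of_nonneg (by positivity)] at h4
  linarith

/-- The vector `v - L_u(v) u` is tangent at `u`, hence at `v`. Pairing it with the conormal at `v`
gives `L_u(v)² = 1`, the level at which the section is a point. -/
theorem IsUmbilicPoint.eq_or_eq_neg_of_parallel {u v : E3} (hu : IsUmbilicPoint α β γ u)
    (hv : IsUmbilicPoint α β γ v)
    (h : (tangentPlane (_root_.ellipsoidForm α β γ) u).Parallel
      (tangentPlane (_root_.ellipsoidForm α β γ) v)) : v = u ∨ v = -u := by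
  have hd := h.direction_eq
  rw [direction_tangentPlane, direction_tangentPlane] at hd
  have hFu := hu.ellipsoidForm hαβ hβγ hγ
  have hFv := hv.ellipsoidForm hαβ hβγ hγ
  have h1 : v - ⟪conormal α β γ u, v⟫ • u ∈ tangentSpace (_root_.ellipsoidForm α β γ) u := by
    rw [mem_tangentSpace, inner_sub_right, inner_smul_right, ← ellipsoidForm_eq_inner, hFu]
    ring
  rw [hd, mem_tangentSpace, inner_sub_right, inner_smul_right, ← ellipsoidForm_eq_inner, hFv,
    inner_conormal_comm α β γ v u] at h1
  exact hu.eq_or_eq_neg hαβ hβγ hγ hFv (by linarith)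

theorem ncard_umbilics : (umbilics (ellipsoidForm α β γ)).ncard = 4 := by
  have hβ : 0 < β := hγ.trans hβγ
  have hα : 0 < α := hβ.trans hαβ
  have h4 : 0 < α - γ := by linarith
  have h5 : 0 < α - β := by linarith
  have h6 : 0 < β - γ := by linarith
  obtain ⟨a, ha, ha2⟩ : ∃ a : ℝ, 0 < a ∧ a ^ 2 = α * (α - β) / (α - γ) :=
    ⟨_, Real.sqrt_pos.2 (by positivity), Real.sq_sqrt (by positivity)⟩
  obtain ⟨c, hc, hc2⟩ : ∃ c : ℝ, 0 < c ∧ c ^ 2 = γ * (β - γ) / (α - γ) :=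
    ⟨_, Real.sqrt_pos.2 (by positivity), Real.sq_sqrt (by positivity)⟩
  have hset : umbilics (ellipsoidForm α β γ) =
      {!₂[a, 0, c], !₂[a, 0, -c], !₂[-a, 0, c], !₂[-a, 0, -c]} := by
    ext p
    rw [mem_umbilics_iff hαβ hβγ hγ, IsUmbilicPoint, ← ha2, ← hc2, sq_eq_sq_iff_eq_or_eq_neg,
      sq_eq_sq_iff_eq_or_eq_neg]
    constructor
    · rintro ⟨h1, h0 | h0, h2 | h2⟩
      · left; exact E3.ext h0 h1 h2
      · right; left; exact E3.ext h0 h1 h2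
      · right; right; left; exact E3.ext h0 h1 h2
      · right; right; right; exact E3.ext h0 h1 h2
    · rintro (rfl | rfl | rfl | rfl) <;> simp
  have hne : ∀ {x y : E3} (i : Fin 3), x i ≠ y i → x ≠ y := fun i h e => h (by rw [e])
  have ha' : a ≠ -a := by linarith
  have hc' : c ≠ -c := by linarith
  rw [hset, Set.ncard_insert_of_notMem, Set.ncard_insert_of_notMem, Set.ncard_pair]
  · exact hne 2 (by simpa using hc')
  · rintro (h | h)
    · exact hne 0 (by simpa using ha') h
    · exact hne 0 (by simpa using ha') h
  · rintro (h | h | h)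
    · exact hne 2 (by simpa using hc') h
    · exact hne 0 (by simpa using ha') h
    · exact hne 0 (by simpa using ha') h

theorem umbilics_neg_and_parallel {u : E3} (hu : u ∈ umbilics (ellipsoidForm α β γ)) :
    -u ∈ umbilics (ellipsoidForm α β γ) ∧
      (tangentPlane (ellipsoidForm α β γ) u).Parallel
        (tangentPlane (ellipsoidForm α β γ) (-u)) := by
  rw [mem_umbilics_iff hαβ hβγ hγ] at hu ⊢
  refine ⟨hu.neg, ?_⟩
  rw [parallel_tangentPlane_iff (hu.neg.ellipsoidForm hαβ hβγ hγ)]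
  refine ⟨-1, fun x => ?_⟩
  rw [mem_tangentPlane (hu.ellipsoidForm hαβ hβγ hγ), map_neg, inner_neg_left, neg_inj]

/-! ### Slicing the ellipsoid into circles -/

theorem existsUnique_parallel_plane {u : E3} (hu : IsUmbilicPoint α β γ u) (x : E3) :
    ∃! P : AffineSubspace ℝ E3,
      P.Parallel (tangentPlane (ellipsoidForm α β γ) u) ∧ x ∈ P := by
  have hF := hu.ellipsoidForm hαβ hβγ hγ
  obtain ⟨P, hP⟩ := exists_plane hF ⟪conormal α β γ u, x⟫
  refine ⟨P, ⟨(parallel_tangentPlane_iff hF).2 ⟨_, hP⟩, (hP x).2 rfl⟩, ?_⟩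
  rintro Q ⟨hQ, hx⟩
  obtain ⟨d, hd⟩ := (parallel_tangentPlane_iff hF).1 hQ
  ext y
  rw [hP, hd, (hd x).1 hx]

theorem parallel_plane_inter {u : E3} (hu : IsUmbilicPoint α β γ u) {P : AffineSubspace ℝ E3}
    (hP : P.Parallel (tangentPlane (ellipsoidForm α β γ) u))
    (hne : (ellipsoid α β γ ∩ P).Nonempty) :
    ∃ c ∈ P, ∃ r : ℝ, 0 ≤ r ∧ ellipsoid α β γ ∩ P = circleIn P c r ∧
      (r = 0 ↔ P = tangentPlane (ellipsoidForm α β γ) u ∨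
        P = tangentPlane (ellipsoidForm α β γ) (-u)) := by
  have hβ : 0 < β := hγ.trans hβγ
  have hF := hu.ellipsoidForm hαβ hβγ hγ
  obtain ⟨d, hd⟩ := (parallel_tangentPlane_iff hF).1 hP
  obtain ⟨x, hx, hxP⟩ := hne
  have hd1 : d ^ 2 ≤ 1 := (hd x).1 hxP ▸ hu.inner_sq_le hαβ hβγ hγ hx
  refine ⟨d • u, hu.smul_mem hαβ hβγ hγ hd, √(β * (1 - d ^ 2)), Real.sqrt_nonneg _,
    hu.section_eq hαβ hβγ hγ hd hd1, ?_⟩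
  rw [Real.sqrt_eq_zero (mul_nonneg hβ.le (by linarith)), mul_eq_zero, or_iff_right hβ.ne',
    sub_eq_zero, eq_comm, sq_eq_one_iff]
  refine or_congr ⟨?_, ?_⟩ ⟨?_, ?_⟩
  · rintro rfl
    ext y
    rw [hd, mem_tangentPlane hF]
  · rintro rfl
    rw [← (hd u).1 (AffineSubspace.self_mem_mk' _ _), ← ellipsoidForm_eq_inner, hF]
  · rintro rfl
    ext y
    rw [hd, mem_tangentPlane (hu.neg.ellipsoidForm hαβ hβγ hγ), map_neg,
      inner_neg_left, neg_eq_iff_eq_neg]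
  · rintro rfl
    rw [← (hd (-u)).1 (AffineSubspace.self_mem_mk' _ _), inner_neg_right, ← ellipsoidForm_eq_inner,
      hF]

/-! ### Tangent planes along a circular cross section -/

theorem exists_common_point_tangentPlanes {P : AffineSubspace ℝ E3}
    (hP : CutsCircle (ellipsoid α β γ) P) :
    ∃ u ∈ umbilics (ellipsoidForm α β γ),
      P.Parallel (tangentPlane (ellipsoidForm α β γ) u) ∧
      ((0 : E3) ∉ P → ∃ q ∈ line[ℝ, u, -u],
        (⋂ x ∈ ellipsoid α β γ ∩ P, (tangentPlane (ellipsoidForm α β γ) x : Set E3)) = {q}) ∧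
      ((0 : E3) ∈ P →
        (⨅ x ∈ ellipsoid α β γ ∩ P, (tangentPlane (ellipsoidForm α β γ) x).direction) =
          (line[ℝ, u, -u]).direction) := by
  have hβ : 0 < β := hγ.trans hβγ
  have hα : 0 < α := hβ.trans hαβ
  obtain ⟨u, d, hu, hd1, hd⟩ := hP.exists_umbilic hαβ hβγ hγ
  have hF := hu.ellipsoidForm hαβ hβγ hγ
  have hsec := hu.section_eq hαβ hβγ hγ hd hd1.le
  set r := √(β * (1 - d ^ 2)) with hr
  have hr0 : 0 < r := Real.sqrt_pos.2 (mul_pos hβ (by linarith))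
  have hmem : ∀ v, ⟪conormal α β γ u, v⟫ = 0 → ‖v‖ = 1 →
      d • u + r • v ∈ ellipsoid α β γ ∩ P := by
    intro v hv hv1
    rw [hsec]
    refine ⟨?_, ?_⟩
    · rw [hd, inner_add_right, inner_smul_right, inner_smul_right, hv, ← ellipsoidForm_eq_inner,
        hF]
      ring
    · rw [dist_eq_norm, add_sub_cancel_left, norm_smul, hv1, mul_one, Real.norm_of_nonneg hr0.le]
  -- A vector conjugate to all points of the circle is conjugate to the plane and to its centre.
  have key : ∀ y, (∀ x ∈ ellipsoid α β γ ∩ P, ⟪conormal α β γ x, y⟫ = 0) →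
      y = ⟪conormal α β γ u, y⟫ • u ∧ d * ⟪conormal α β γ u, y⟫ = 0 := by
    intro y hy
    have h1 : ∀ v, ⟪conormal α β γ u, v⟫ = 0 → ‖v‖ = 1 →
        ⟪conormal α β γ v, y⟫ = 0 ∧ d * ⟪conormal α β γ u, y⟫ = 0 := by
      intro v hv hv1
      have e1 := hy _ (hmem v hv hv1)
      have e2 := hy _ (hmem (-v) (by rw [inner_neg_right, hv, neg_zero]) (by rw [norm_neg, hv1]))
      simp only [map_add, map_smul, map_neg, inner_add_left, inner_smul_left, inner_neg_left,
        conj_trivial] at e1 e2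
      have e3 : r * ⟪conormal α β γ v, y⟫ = 0 := by linarith
      exact ⟨(mul_eq_zero.1 e3).resolve_left hr0.ne', by linarith⟩
    constructor
    -- The component `w` of `y` tangent at `u` is conjugate both to `y` and to `u`, hence to itself;
    -- since `F` is definite, `w = 0`.
    · by_contra hne
      set w := y - ⟪conormal α β γ u, y⟫ • u with hw
      have hw0 : w ≠ 0 := fun h => hne (sub_eq_zero.1 h)
      have hw' : ‖w‖ ≠ 0 := norm_ne_zero_iff.2 hw0
      have hwu : ⟪conormal α β γ u, w⟫ = 0 := by
        rw [hw, inner_sub_right, inner_smul_right, ← ellipsoidForm_eq_inner, hF]; ring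
      have h2 := (h1 (‖w‖⁻¹ • w) (by rw [inner_smul_right, hwu, mul_zero])
        (by rw [norm_smul, norm_inv, norm_norm, inv_mul_cancel₀ hw'])).1
      have h3 : ⟪conormal α β γ w, y⟫ = 0 := by
        simpa [inner_smul_left, hw'] using h2
      have h4 : ellipsoidForm α β γ w = 0 := by
        rw [ellipsoidForm_eq_inner]
        nth_rewrite 2 [hw]
        rw [inner_sub_right, h3, inner_smul_right, inner_conormal_comm α β γ w u, hwu]
        ring
      rw [hu.form_eq_of_tangent hαβ hβγ hγ hwu] at h4
      simp [hβ.ne', hw0] at h4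
    · obtain ⟨v, hv, hv1⟩ := exists_norm_eq_one_of_finrank (finrank_tangentSpace hF)
      exact (h1 v (mem_tangentSpace.1 hv) hv1).2
  refine ⟨u, (mem_umbilics_iff hαβ hβγ hγ).2 hu, (parallel_tangentPlane_iff hF).2 ⟨d, hd⟩, ?_, ?_⟩
  · intro h0
    have hd0 : d ≠ 0 := by
      rintro rfl
      exact h0 ((hd 0).2 (inner_zero_right _))
    -- This is the pole of the plane `L_u = d`: by symmetry of the polar form, `L_x(u / d) = L_u(x)
    -- / d = 1` along the circle.
    refine ⟨d⁻¹ • u, ?_, ?_⟩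
    · have : d⁻¹ • u = AffineMap.lineMap u (-u) ((1 - d⁻¹) / 2) := by
        rw [AffineMap.lineMap_apply_module]
        module
      rw [this]
      exact AffineMap.lineMap_mem_affineSpan_pair _ _ _
    · have hq : ∀ x ∈ ellipsoid α β γ ∩ P, ⟪conormal α β γ x, d⁻¹ • u⟫ = 1 := by
        intro x hx
        rw [inner_smul_right, inner_conormal_comm, (hd x).1 hx.2, inv_mul_cancel₀ hd0]
      ext y
      simp only [mem_iInter, mem_singleton_iff, SetLike.mem_coe]
      constructor
      · intro hy
        have h2 := key (y - d⁻¹ • u) (fun x hx => by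
          rw [inner_sub_right, hq x hx, (mem_tangentPlane hx.1).1 (hy x hx), sub_self])
        have h3 := (mul_eq_zero.1 h2.2).resolve_left hd0
        rw [h3, zero_smul] at h2
        exact sub_eq_zero.1 h2.1
      · rintro rfl x hx
        exact (mem_tangentPlane hx.1).2 (hq x hx)
  · intro h0
    have hd0 : d = 0 := by rw [← (hd 0).1 h0, inner_zero_right]
    have hdir : (line[ℝ, u, -u]).direction = Submodule.span ℝ {u} := by
      rw [direction_affineSpan, vectorSpan_eq_span_vsub_set_right ℝ
        (mem_insert_of_mem u (mem_singleton (-u))),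
        Set.image_pair, vsub_self, Set.pair_comm, Submodule.span_insert_zero, vsub_eq_sub]
      have : u - -u = (2 : ℝ) • u := by module
      rw [this, Submodule.span_singleton_smul_eq (IsUnit.mk0 _ two_ne_zero)]
    rw [hdir]
    ext y
    simp only [Submodule.mem_iInf, direction_tangentPlane, mem_tangentSpace,
      Submodule.mem_span_singleton]
    constructor
    · intro hy
      exact ⟨_, (key y hy).1.symm⟩
    · rintro ⟨t, rfl⟩ x hx
      rw [inner_smul_right, inner_conormal_comm, (hd x).1 hx.2, hd0, mul_zero]

end Ordered

/-! ### Deformation of the ellipsoid with rigid circular cross sections -/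

/-- The diagonal map taking the ellipsoid with squared semi-axes `α, β, γ` to the one with squared
semi-axes `α', β, γ'`. -/
def axisScaling (α γ α' γ' : ℝ) : E3 →L[ℝ] E3 := diagMap √(α' / α) 1 √(γ' / γ)

section AxisScaling

variable {α β γ α' γ' : ℝ}

theorem inner_conormal_axisScaling (hα : 0 < α) (hγ : 0 < γ) (hα' : 0 < α') (hγ' : 0 < γ')
    (x y : E3) :
    ⟪conormal α' β γ' (axisScaling α γ α' γ' x), axisScaling α γ α' γ' y⟫ =
      ⟪conormal α β γ x, y⟫ := by
  rw [inner_conormal, inner_conormal]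
  simp only [axisScaling, diagMap_apply_zero, diagMap_apply_one, diagMap_apply_two]
  have h1 : √(α' / α) ^ 2 = α' / α := Real.sq_sqrt (by positivity)
  have h2 : √(γ' / γ) ^ 2 = γ' / γ := Real.sq_sqrt (by positivity)
  have e1 : √(α' / α) * x 0 * (√(α' / α) * y 0) / α' = x 0 * y 0 / α := by
    rw [show √(α' / α) * x 0 * (√(α' / α) * y 0) = √(α' / α) ^ 2 * (x 0 * y 0) by ring, h1]
    field_simp
  have e2 : √(γ' / γ) * x 2 * (√(γ' / γ) * y 2) / γ' = x 2 * y 2 / γ := by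
    rw [show √(γ' / γ) * x 2 * (√(γ' / γ) * y 2) = √(γ' / γ) ^ 2 * (x 2 * y 2) by ring, h2]
    field_simp
  rw [e1, e2, one_mul, one_mul]

theorem ellipsoidForm_axisScaling (hα : 0 < α) (hγ : 0 < γ) (hα' : 0 < α') (hγ' : 0 < γ')
    (x : E3) :
    ellipsoidForm α' β γ' (axisScaling α γ α' γ' x) = ellipsoidForm α β γ x := by
  rw [ellipsoidForm_eq_inner, inner_conormal_axisScaling hα hγ hα' hγ', ellipsoidForm_eq_inner]

theorem axisScaling_axisScaling (hα : 0 < α) (hγ : 0 < γ) (hα' : 0 < α') (hγ' : 0 < γ')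
    (x : E3) : axisScaling α γ α' γ' (axisScaling α' γ' α γ x) = x := by
  have h1 : √(α' / α) * √(α / α') = 1 := by
    rw [← Real.sqrt_mul (by positivity), div_mul_div_cancel₀ hα.ne', div_self hα'.ne',
      Real.sqrt_one]
  have h2 : √(γ' / γ) * √(γ / γ') = 1 := by
    rw [← Real.sqrt_mul (by positivity), div_mul_div_cancel₀ hγ.ne', div_self hγ'.ne',
      Real.sqrt_one]
  apply E3.ext <;>
    simp only [axisScaling, diagMap_apply_zero, diagMap_apply_one, diagMap_apply_two,
      ← mul_assoc, h1, h2, one_mul]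

theorem image_axisScaling (hα : 0 < α) (hγ : 0 < γ) (hα' : 0 < α') (hγ' : 0 < γ') (C : Set E3) :
    axisScaling α γ α' γ' '' C = axisScaling α' γ' α γ ⁻¹' C :=
  congrFun (Set.image_eq_preimage_of_inverse (axisScaling_axisScaling hα' hγ' hα hγ)
    (axisScaling_axisScaling hα hγ hα' hγ')) C

theorem image_axisScaling_ellipsoid (hα : 0 < α) (hγ : 0 < γ) (hα' : 0 < α') (hγ' : 0 < γ') :
    axisScaling α γ α' γ' '' ellipsoid α β γ = ellipsoid α' β γ' := by
  rw [image_axisScaling hα hγ hα' hγ']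
  ext x
  simp only [ellipsoid, mem_preimage, mem_ofPred_eq,
    ellipsoidForm_axisScaling hα' hγ' hα hγ]

/-- After pulling back to the unit sphere, the umbilics depend only on the ratio `(α - β) / (α -
γ)`, and `hrel` says that this ratio is the same for both ellipsoids. -/
theorem IsUmbilicPoint.axisScaling (hαβ : α > β) (hβγ : β > γ) (hγ : γ > 0)
    (hαβ' : α' > β) (hβγ' : β > γ') (hγ' : γ' > 0)
    (hrel : (α' - β) * (α - γ) = (α - β) * (α' - γ'))
    {u : E3} (hu : IsUmbilicPoint α β γ u) :
    IsUmbilicPoint α' β γ' (axisScaling α γ α' γ' u) := by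
  obtain ⟨h1, h0, h2⟩ := hu
  have hα : 0 < α := by linarith
  have hα' : 0 < α' := by linarith
  have hd : 0 < α - γ := by linarith
  have hd' : 0 < α' - γ' := by linarith
  refine ⟨?_, ?_, ?_⟩
  · simp [_root_.axisScaling, h1]
  · rw [_root_.axisScaling, diagMap_apply_zero, mul_pow, h0, Real.sq_sqrt (by positivity)]
    field_simp
    linear_combination -hrel
  · rw [_root_.axisScaling, diagMap_apply_two, mul_pow, h2, Real.sq_sqrt (by positivity)]
    field_simp
    linear_combination hrel

end AxisScaling

theorem mem_circularSections_iff {α β γ : ℝ} (hαβ : α > β) (hβγ : β > γ) (hγ : γ > 0)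
    {C : Set E3} :
    C ∈ circularSections (ellipsoid α β γ) ↔ ∃ (u : E3) (d : ℝ), IsUmbilicPoint α β γ u ∧
      d ^ 2 < 1 ∧ C = {x | x ∈ ellipsoid α β γ ∧ ⟪conormal α β γ u, x⟫ = d} := by
  constructor
  · rintro ⟨P, hP, rfl⟩
    obtain ⟨u, d, hu, hd, h⟩ := hP.exists_umbilic hαβ hβγ hγ
    refine ⟨u, d, hu, hd, ?_⟩
    ext x
    exact and_congr_right fun _ => h x
  · rintro ⟨u, d, hu, hd, rfl⟩
    obtain ⟨P, hP⟩ := exists_plane (hu.ellipsoidForm hαβ hβγ hγ) d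
    refine ⟨P, hu.cutsCircle hαβ hβγ hγ hP hd, ?_⟩
    ext x
    exact and_congr_right fun _ => (hP x).symm

section AxisScaling

variable {α β γ α' γ' : ℝ} (hαβ : α > β) (hβγ : β > γ) (hγ : γ > 0)
  (hαβ' : α' > β) (hβγ' : β > γ') (hγ' : γ' > 0)
  (hrel : (α' - β) * (α - γ) = (α - β) * (α' - γ'))
include hαβ hβγ hγ hαβ' hβγ' hγ' hrel

/-- The chord `x - y` is tangent at an umbilic, and so is its image. On such vectors both quadratic
forms equal `‖·‖² / β` with the same `β`, and the map carries one form to the other, so lengths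
agree. -/
theorem dist_axisScaling_of_mem_section {C : Set E3}
    (hC : C ∈ circularSections (ellipsoid α β γ)) {x y : E3} (hx : x ∈ C) (hy : y ∈ C) :
    dist (axisScaling α γ α' γ' x) (axisScaling α γ α' γ' y) = dist x y := by
  have hβ : 0 < β := hγ.trans hβγ
  have hα : 0 < α := hβ.trans hαβ
  have hα' : 0 < α' := hβ.trans hαβ'
  obtain ⟨u, d, hu, -, rfl⟩ := (mem_circularSections_iff hαβ hβγ hγ).1 hC
  have hu' := hu.axisScaling hαβ hβγ hγ hαβ' hβγ' hγ' hrel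
  have hv : ⟪conormal α β γ u, x - y⟫ = 0 := by rw [inner_sub_right, hx.2, hy.2, sub_self]
  have hv' : ⟪conormal α' β γ' (axisScaling α γ α' γ' u), axisScaling α γ α' γ' (x - y)⟫ = 0 := by
    rw [inner_conormal_axisScaling hα hγ hα' hγ', hv]
  have h1 := hu.form_eq_of_tangent hαβ hβγ hγ hv
  have h2 := hu'.form_eq_of_tangent hαβ' hβγ' hγ' hv'
  rw [ellipsoidForm_axisScaling hα hγ hα' hγ', h1, div_left_inj' hβ.ne', map_sub] at h2
  rw [dist_eq_norm, dist_eq_norm]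
  exact ((sq_eq_sq₀ (norm_nonneg _) (norm_nonneg _)).1 h2).symm

theorem image_axisScaling_mem_circularSections {C : Set E3}
    (hC : C ∈ circularSections (ellipsoid α β γ)) :
    axisScaling α γ α' γ' '' C ∈ circularSections (ellipsoid α' β γ') := by
  have hα : 0 < α := by linarith
  have hα' : 0 < α' := by linarith
  rw [mem_circularSections_iff hαβ hβγ hγ] at hC
  rw [mem_circularSections_iff hαβ' hβγ' hγ']
  obtain ⟨u, d, hu, hd, rfl⟩ := hC
  refine ⟨_, d, hu.axisScaling hαβ hβγ hγ hαβ' hβγ' hγ' hrel, hd, ?_⟩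
  rw [image_axisScaling hα hγ hα' hγ']
  ext x
  simp only [ellipsoid, mem_preimage, mem_ofPred_eq]
  rw [ellipsoidForm_axisScaling hα' hγ' hα hγ]
  rw [← inner_conormal_axisScaling hα hγ hα' hγ', axisScaling_axisScaling hα hγ hα' hγ']

theorem image_circularSections_axisScaling :
    (fun C => axisScaling α γ α' γ' '' C) '' circularSections (ellipsoid α β γ) =
      circularSections (ellipsoid α' β γ') := by
  have hα : 0 < α := by linarith
  have hα' : 0 < α' := by linarith
  apply Subset.antisymm
  · rintro _ ⟨C, hC, rfl⟩
    exact image_axisScaling_mem_circularSections hαβ hβγ hγ hαβ' hβγ' hγ' hrel hC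
  · intro C hC
    refine ⟨axisScaling α' γ' α γ '' C, image_axisScaling_mem_circularSections hαβ' hβγ' hγ'
      hαβ hβγ hγ (by linear_combination -hrel) hC, ?_⟩
    simp only [image_image, axisScaling_axisScaling hα hγ hα' hγ', image_id']

end AxisScaling

theorem smul_ellipsoid {k : ℝ} (hk : 0 < k) (a b c : ℝ) :
    k • ellipsoid a b c = ellipsoid (k ^ 2 * a) (k ^ 2 * b) (k ^ 2 * c) := by
  ext x
  rw [mem_smul_set_iff_inv_smul_mem₀ hk.ne']
  simp only [ellipsoid, ellipsoidForm, mem_ofPred_eq, PiLp.smul_apply, smul_eq_mul]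
  refine Eq.congr ?_ rfl
  congr 1
  · congr 1 <;> field_simp
  · field_simp

theorem exists_deformation {α β γ : ℝ} (hαβ : α > β) (hβγ : β > γ) (hγ : γ > 0) :
    ∃ Φ : ℝ → E3 →L[ℝ] E3,
      ContinuousOn Φ (Ioi (-γ)) ∧ Φ 0 = ContinuousLinearMap.id ℝ E3 ∧
      (∀ l ∈ Ioi (-γ),
        Φ l '' ellipsoid α β γ =
          Real.sqrt (β / (β + l)) • ellipsoid (α + l) (β + l) (γ + l) ∧
        (∀ C ∈ circularSections (ellipsoid α β γ), ∀ x ∈ C, ∀ y ∈ C,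
          dist (Φ l x) (Φ l y) = dist x y) ∧
        (fun C => Φ l '' C) '' circularSections (ellipsoid α β γ) =
          circularSections (Φ l '' ellipsoid α β γ)) ∧
      (∀ l ∈ Ioi (-γ), ∀ m ∈ Ioi (-γ), ∃ k : ℝ, 0 < k ∧
        AreConfocal (Φ l '' ellipsoid α β γ) (k • (Φ m '' ellipsoid α β γ))) := by
  have hβ : 0 < β := hγ.trans hβγ
  have hα : 0 < α := hβ.trans hαβ
  have himg : ∀ l ∈ Ioi (-γ), axisScaling α γ (β / (β + l) * (α + l)) (β / (β + l) * (γ + l)) ''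
      ellipsoid α β γ = √(β / (β + l)) • ellipsoid (α + l) (β + l) (γ + l) := by
    intro l hl
    have hγl : 0 < γ + l := by linarith [mem_Ioi.1 hl]
    have hβl : 0 < β + l := by linarith
    have hαl : 0 < α + l := by linarith
    have h0 : 0 < β / (β + l) := by positivity
    rw [image_axisScaling_ellipsoid hα hγ (by positivity) (by positivity),
      smul_ellipsoid (Real.sqrt_pos.2 h0), Real.sq_sqrt h0.le, div_mul_cancel₀ _ hβl.ne']
  -- The squared semi-axes of the confocal ellipsoid are multiplied by `β / (β + l)`, which brings
  -- the middle one back to `β`.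
  refine ⟨fun l => axisScaling α γ (β / (β + l) * (α + l)) (β / (β + l) * (γ + l)),
    ?_, ?_, ?_, ?_⟩
  · have hne : ∀ l ∈ Ioi (-γ), β + l ≠ 0 := fun l hl => by linarith [mem_Ioi.1 hl]
    simp only [axisScaling, diagMap]
    fun_prop (disch := assumption)
  · ext1 x
    apply E3.ext <;> simp [axisScaling, hα.ne', hβ.ne', hγ.ne']
  · intro l hl
    have hγl : 0 < γ + l := by linarith [mem_Ioi.1 hl]
    have hβl : 0 < β + l := by linarith
    have hαl : 0 < α + l := by linarith
    have h1 : β / (β + l) * (α + l) > β := by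
      rw [gt_iff_lt, div_mul_eq_mul_div, lt_div_iff₀ hβl]
      exact mul_lt_mul_of_pos_left (by linarith) hβ
    have h2 : β > β / (β + l) * (γ + l) := by
      rw [gt_iff_lt, div_mul_eq_mul_div, div_lt_iff₀ hβl]
      exact mul_lt_mul_of_pos_left (by linarith) hβ
    have h3 : β / (β + l) * (γ + l) > 0 := by positivity
    have hrel : (β / (β + l) * (α + l) - β) * (α - γ) =
        (α - β) * (β / (β + l) * (α + l) - β / (β + l) * (γ + l)) := by
      field_simp; ring
    refine ⟨himg l hl, fun C hC x hx y hy =>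
      dist_axisScaling_of_mem_section hαβ hβγ hγ h1 h2 h3 hrel hC hx hy, ?_⟩
    rw [image_axisScaling_ellipsoid hα hγ (by positivity) (by positivity)]
    exact image_circularSections_axisScaling hαβ hβγ hγ h1 h2 h3 hrel
  · intro l hl m hm
    have hγl : 0 < γ + l := by linarith [mem_Ioi.1 hl]
    have hγm : 0 < γ + m := by linarith [mem_Ioi.1 hm]
    have hβl : 0 < β + l := by linarith
    have hβm : 0 < β + m := by linarith
    have hl0 : 0 < β / (β + l) := by positivity
    have hm0 : 0 < β / (β + m) := by positivity
    have hl1 := Real.sqrt_pos.2 hl0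
    have hm1 := Real.sqrt_pos.2 hm0
    -- This factor replaces the normalization belonging to `m` by that belonging to `l`; the squared
    -- semi-axes then differ by `β / (β + l) * (m - l)`.
    refine ⟨√(β / (β + l)) / √(β / (β + m)), div_pos hl1 hm1, ?_⟩
    simp only [himg l hl, himg m hm, smul_smul, div_mul_cancel₀ _ hm1.ne']
    refine ⟨β / (β + l) * (α + l), β / (β + l) * (β + l), β / (β + l) * (γ + l),
      β / (β + l) * (m - l), mul_lt_mul_of_pos_left (by linarith) hl0,
      mul_lt_mul_of_pos_left (by linarith) hl0, by positivity, ?_, ?_, ?_⟩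
    · rw [← mul_add]
      exact mul_pos hl0 (by linarith)
    · rw [smul_ellipsoid hl1, Real.sq_sqrt hl0.le]
    · rw [smul_ellipsoid hl1, Real.sq_sqrt hl0.le]
      congr 1 <;> ring

/-! ### Principal directions of the ellipsoid -/

section Principal

variable {α β γ : ℝ} {p e₁ e₂ : E3} {l₁ l₂ : ℝ}

/-- Two orthogonal conjugate tangent vectors span the principal directions. -/
theorem weingarten_add_of_conjugate (hp : ellipsoidForm α β γ p = 1)
    (h₁ : e₁ ∈ tangentSpace (ellipsoidForm α β γ) p)
    (h₂ : e₂ ∈ tangentSpace (ellipsoidForm α β γ) p)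
    (hn₁ : e₁ ≠ 0) (hn₂ : e₂ ≠ 0) (ho : ⟪e₁, e₂⟫ = 0) (hc : ⟪conormal α β γ e₁, e₂⟫ = 0)
    (hl₁ : ellipsoidForm α β γ e₁ = l₁ * ‖e₁‖ ^ 2)
    (hl₂ : ellipsoidForm α β γ e₂ = l₂ * ‖e₂‖ ^ 2) :
    (∀ w ∈ tangentSpace (ellipsoidForm α β γ) p, ∃ s t : ℝ, s • e₁ + t • e₂ = w) ∧
    (∀ s t : ℝ, weingarten (ellipsoidForm α β γ) p (s • e₁ + t • e₂) =
      ‖conormal α β γ p‖⁻¹ • ((s * l₁) • e₁ + (t * l₂) • e₂)) := by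
  have hspan : ∀ w ∈ tangentSpace (ellipsoidForm α β γ) p, ∃ s t : ℝ, s • e₁ + t • e₂ = w := by
    have hli : LinearIndependent ℝ ![e₁, e₂] := by
      rw [LinearIndependent.pair_iff]
      intro s t hst
      have i1 := congrArg (fun v => ⟪e₁, v⟫) hst
      have i2 := congrArg (fun v => ⟪v, e₂⟫) hst
      simp only [inner_add_left, inner_add_right, inner_smul_left, inner_smul_right, ho,
        inner_zero_left, inner_zero_right, mul_zero, add_zero, zero_add, mul_eq_zero,
        inner_self_eq_zero, hn₁, hn₂, or_false, conj_trivial] at i1 i2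
      exact ⟨i1, i2⟩
    have hle : Submodule.span ℝ {e₁, e₂} ≤ tangentSpace (ellipsoidForm α β γ) p := by
      rw [Submodule.span_le]
      rintro v (rfl | rfl)
      exacts [h₁, h₂]
    have hfin : Module.finrank ℝ (Submodule.span ℝ {e₁, e₂}) = 2 := by
      have := finrank_span_eq_card hli
      rwa [Matrix.range_cons_cons_empty, Fintype.card_fin] at this
    have heq := Submodule.eq_of_le_of_finrank_eq hle (by rw [hfin, finrank_tangentSpace hp])
    intro w hw
    rw [← heq] at hw
    exact Submodule.mem_span_pair.1 hw
  refine ⟨hspan, fun s t => ?_⟩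
  obtain ⟨hW, hW2⟩ := weingarten_ellipsoidForm hp (s • e₁ + t • e₂)
  obtain ⟨x, y, hxy⟩ := hspan _ hW
  have c1 := hW2 e₁ h₁
  have c2 := hW2 e₂ h₂
  have ho' : ⟪e₂, e₁⟫ = 0 := by rw [real_inner_comm, ho]
  have hc' : ⟪conormal α β γ e₂, e₁⟫ = 0 := by rw [inner_conormal_comm, hc]
  rw [← hxy] at c1 c2
  simp only [map_add, map_smul, inner_add_left, inner_smul_left, ho, ho', hc, hc', conj_trivial,
    mul_zero, add_zero, zero_add, ← ellipsoidForm_eq_inner, hl₁, hl₂,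
    real_inner_self_eq_norm_sq] at c1 c2
  have q₁ : ‖e₁‖ ^ 2 ≠ 0 := by simpa using hn₁
  have q₂ : ‖e₂‖ ^ 2 ≠ 0 := by simpa using hn₂
  have hx : x = ‖conormal α β γ p‖⁻¹ * (s * l₁) :=
    mul_right_cancel₀ q₁ (by linear_combination c1)
  have hy : y = ‖conormal α β γ p‖⁻¹ * (t * l₂) :=
    mul_right_cancel₀ q₂ (by linear_combination c2)
  rw [← hxy, hx, hy]
  module

/-- The Weingarten map is diagonal in the orthogonal basis `e₁, e₂`, with eigenvalues `l₁ > l₂`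
times `‖conormal p‖⁻¹`; the eigenspaces are therefore lines. -/
theorem principal_iff (hp : ellipsoidForm α β γ p = 1)
    (h₁ : e₁ ∈ tangentSpace (ellipsoidForm α β γ) p)
    (h₂ : e₂ ∈ tangentSpace (ellipsoidForm α β γ) p)
    (hn₁ : e₁ ≠ 0) (hn₂ : e₂ ≠ 0) (ho : ⟪e₁, e₂⟫ = 0) (hc : ⟪conormal α β γ e₁, e₂⟫ = 0)
    (hl₁ : ellipsoidForm α β γ e₁ = l₁ * ‖e₁‖ ^ 2)
    (hl₂ : ellipsoidForm α β γ e₂ = l₂ * ‖e₂‖ ^ 2) (hl : l₂ < l₁) (v : E3) :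
    (IsMaxPrincipal (ellipsoidForm α β γ) p v ↔ ∃ t : ℝ, t ≠ 0 ∧ v = t • e₁) ∧
    (IsMinPrincipal (ellipsoidForm α β γ) p v ↔ ∃ t : ℝ, t ≠ 0 ∧ v = t • e₂) := by
  obtain ⟨hspan, hW⟩ := weingarten_add_of_conjugate hp h₁ h₂ hn₁ hn₂ ho hc hl₁ hl₂
  have ho' : ⟪e₂, e₁⟫ = 0 := by rw [real_inner_comm, ho]
  have q₁ : 0 < ‖e₁‖ ^ 2 := by positivity
  have q₂ : 0 < ‖e₂‖ ^ 2 := by positivity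
  have hh : 0 < ‖conormal α β γ p‖⁻¹ := inv_pos.2 (norm_pos_iff.2 (conormal_ne_zero hp))
  have hnorm : ∀ s t : ℝ, ‖s • e₁ + t • e₂‖ ^ 2 = s ^ 2 * ‖e₁‖ ^ 2 + t ^ 2 * ‖e₂‖ ^ 2 := by
    intro s t
    rw [norm_add_sq_real, norm_smul, norm_smul, inner_smul_left, inner_smul_right, ho, mul_pow,
      mul_pow, Real.norm_eq_abs, Real.norm_eq_abs, sq_abs, sq_abs]
    ring
  have hquad : ∀ s t : ℝ, ⟪weingarten (ellipsoidForm α β γ) p (s • e₁ + t • e₂),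
      s • e₁ + t • e₂⟫ =
      ‖conormal α β γ p‖⁻¹ * (s ^ 2 * l₁ * ‖e₁‖ ^ 2 + t ^ 2 * l₂ * ‖e₂‖ ^ 2) := by
    intro s t
    rw [hW]
    simp only [inner_add_left, inner_add_right, inner_smul_left, inner_smul_right, ho, ho',
      conj_trivial, real_inner_self_eq_norm_sq]
    ring
  have hW₁ : weingarten (ellipsoidForm α β γ) p e₁ = (‖conormal α β γ p‖⁻¹ * l₁) • e₁ := by
    simpa [smul_smul] using hW 1 0
  have hW₂ : weingarten (ellipsoidForm α β γ) p e₂ = (‖conormal α β γ p‖⁻¹ * l₂) • e₂ := by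
    simpa [smul_smul] using hW 0 1
  have hq₁ : ⟪weingarten (ellipsoidForm α β γ) p e₁, e₁⟫ =
      ‖conormal α β γ p‖⁻¹ * l₁ * ‖e₁‖ ^ 2 := by
    rw [hW₁, inner_smul_left, real_inner_self_eq_norm_sq, conj_trivial]
  have hq₂ : ⟪weingarten (ellipsoidForm α β γ) p e₂, e₂⟫ =
      ‖conormal α β γ p‖⁻¹ * l₂ * ‖e₂‖ ^ 2 := by
    rw [hW₂, inner_smul_left, real_inner_self_eq_norm_sq, conj_trivial]
  have heig : ∀ (k s t : ℝ), weingarten (ellipsoidForm α β γ) p (s • e₁ + t • e₂) =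
      k • (s • e₁ + t • e₂) →
      s * (‖conormal α β γ p‖⁻¹ * l₁ - k) = 0 ∧ t * (‖conormal α β γ p‖⁻¹ * l₂ - k) = 0 := by
    intro k s t h
    rw [hW] at h
    have i1 := congrArg (fun v => ⟪v, e₁⟫) h
    have i2 := congrArg (fun v => ⟪v, e₂⟫) h
    simp only [inner_add_left, inner_smul_left, ho, ho', conj_trivial,
      real_inner_self_eq_norm_sq, mul_zero, add_zero, zero_add] at i1 i2
    exact ⟨mul_right_cancel₀ q₁.ne' (by linear_combination i1),
      mul_right_cancel₀ q₂.ne' (by linear_combination i2)⟩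
  have hlt : ‖conormal α β γ p‖⁻¹ * l₂ < ‖conormal α β γ p‖⁻¹ * l₁ := mul_lt_mul_of_pos_left hl hh
  constructor
  · constructor
    · rintro ⟨hv0, hv, k, hk, hle⟩
      obtain ⟨s, t, rfl⟩ := hspan v hv
      -- Testing the extremal inequality at `e₁` bounds `k` below by the larger eigenvalue, so the
      -- `e₂` component of the eigenvector vanishes.
      have h3 := hle e₁ h₁
      rw [hq₁] at h3
      have h4 := le_of_mul_le_mul_right h3 q₁
      have ht : t = 0 := (mul_eq_zero.1 (heig k s t hk).2).resolve_right (by linarith)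
      subst ht
      rw [zero_smul, add_zero] at hv0 ⊢
      exact ⟨s, fun h => hv0 (by rw [h, zero_smul]), rfl⟩
    · rintro ⟨t, ht, rfl⟩
      refine ⟨smul_ne_zero ht hn₁, Submodule.smul_mem _ t h₁, ‖conormal α β γ p‖⁻¹ * l₁, ?_, ?_⟩
      · rw [map_smul, hW₁, smul_comm]
      · intro w hw
        obtain ⟨x, y, rfl⟩ := hspan w hw
        rw [hquad, hnorm]
        have : 0 ≤ y ^ 2 * ‖e₂‖ ^ 2 * (‖conormal α β γ p‖⁻¹ * l₁ - ‖conormal α β γ p‖⁻¹ * l₂) :=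
          mul_nonneg (by positivity) (by linarith)
        linear_combination this
  · constructor
    · rintro ⟨hv0, hv, k, hk, hle⟩
      obtain ⟨s, t, rfl⟩ := hspan v hv
      have h3 := hle e₂ h₂
      rw [hq₂] at h3
      have h4 := le_of_mul_le_mul_right h3 q₂
      have hs : s = 0 := (mul_eq_zero.1 (heig k s t hk).1).resolve_right (by linarith)
      subst hs
      rw [zero_smul, zero_add] at hv0 ⊢
      exact ⟨t, fun h => hv0 (by rw [h, zero_smul]), rfl⟩
    · rintro ⟨t, ht, rfl⟩
      refine ⟨smul_ne_zero ht hn₂, Submodule.smul_mem _ t h₂, ‖conormal α β γ p‖⁻¹ * l₂, ?_, ?_⟩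
      · rw [map_smul, hW₂, smul_comm]
      · intro w hw
        obtain ⟨x, y, rfl⟩ := hspan w hw
        rw [hquad, hnorm]
        have : 0 ≤ x ^ 2 * ‖e₁‖ ^ 2 * (‖conormal α β γ p‖⁻¹ * l₁ - ‖conormal α β γ p‖⁻¹ * l₂) :=
          mul_nonneg (by positivity) (by linarith)
        linear_combination this

end Principal

/-! ### Foliations by the integral curves of a direction field -/

/-- A parametrization `Ψ` of a surface by a torus, branched over the points with
`sin θ = sin φ = 0`, together with a function `a` of `θ` alone: the curves `θ = const` are the
integral curves of the direction field `dir`, and `g` is a substitute for `a` near the curves with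
`sin θ = 0`, where the differential of `a` vanishes. -/
structure CurveChart (F : E3 → ℝ) (S : Set E3) (dir : E3 → E3 → Prop) where
  /-- the parametrization -/
  Ψ : ℝ → ℝ → E3
  /-- its derivative with respect to the first variable -/
  Ψθ : ℝ → ℝ → E3
  /-- its derivative with respect to the second variable -/
  Ψφ : ℝ → ℝ → E3
  /-- the modulus -/
  k : ℝ
  /-- the function of the first variable -/
  a : E3 → ℝ
  /-- the substitute for `a` near `sin θ = 0` -/
  g : E3 → ℝ
  /-- the domain of smoothness of `a` -/
  U : Set E3
  /-- the domain of smoothness of `g` -/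
  V : Set E3
  k_pos : 0 < k
  k_lt_one : k < 1
  surj : ∀ p ∈ S, ∃ θ φ, Ψ θ φ = p
  mem_iff : ∀ θ φ, Ψ θ φ ∈ S ↔ ¬(Real.sin θ = 0 ∧ Real.sin φ = 0)
  congr_left : ∀ θ θ' φ, Real.cos θ = Real.cos θ' → Real.sin θ = Real.sin θ' → Ψ θ φ = Ψ θ' φ
  congr_right : ∀ θ φ φ', Real.cos φ = Real.cos φ' → Real.sin φ = Real.sin φ' → Ψ θ φ = Ψ θ φ'
  neg_neg : ∀ θ φ, Ψ (-θ) (-φ) = Ψ θ φ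
  hasDerivAt_left : ∀ θ φ, HasDerivAt (fun t => Ψ t φ) (Ψθ θ φ) θ
  hasDerivAt_right : ∀ θ φ, HasDerivAt (fun t => Ψ θ t) (Ψφ θ φ) φ
  contDiff_right : ∀ θ, ContDiff ℝ 1 (fun t => Ψ θ t)
  mem_tangentSpace : ∀ θ φ, Ψ θ φ ∈ S → Ψθ θ φ ∈ tangentSpace F (Ψ θ φ)
  dir_iff : ∀ θ φ, Ψ θ φ ∈ S → ∀ v, dir (Ψ θ φ) v ↔ ∃ t : ℝ, t ≠ 0 ∧ v = t • Ψφ θ φ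
  a_eq : ∀ θ φ, a (Ψ θ φ) = Real.arcsin (k * Real.cos θ)
  a_continuous : Continuous a
  U_open : IsOpen U
  U_subset : S ⊆ U
  a_contDiffOn : ContDiffOn ℝ 1 a U
  V_open : IsOpen V
  mem_V_iff : ∀ θ φ, Ψ θ φ ∈ S → (Ψ θ φ ∈ V ↔ Real.sin φ ≠ 0)
  g_eq : ∀ θ φ, Real.sin φ ≠ 0 → g (Ψ θ φ) = Real.sin θ * (Real.sin φ / |Real.sin φ|)
  g_contDiffOn : ContDiffOn ℝ 1 g V

namespace CurveChart

variable {F : E3 → ℝ} {S : Set E3} {dir : E3 → E3 → Prop} (X : CurveChart F S dir)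

theorem abs_k_mul_cos_lt (θ : ℝ) : |X.k * Real.cos θ| < 1 := by
  rw [abs_mul, abs_of_pos X.k_pos]
  calc X.k * |Real.cos θ| ≤ X.k * 1 :=
        mul_le_mul_of_nonneg_left (Real.abs_cos_le_one θ) X.k_pos.le
    _ < 1 := by rw [mul_one]; exact X.k_lt_one

theorem a_eq_iff (θ φ θ' φ' : ℝ) :
    X.a (X.Ψ θ φ) = X.a (X.Ψ θ' φ') ↔ Real.cos θ = Real.cos θ' := by
  have h := X.abs_k_mul_cos_lt
  rw [X.a_eq, X.a_eq, Real.arcsin_inj (abs_lt.1 (h θ)).1.le (abs_lt.1 (h θ)).2.le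
    (abs_lt.1 (h θ')).1.le (abs_lt.1 (h θ')).2.le, mul_right_inj' X.k_pos.ne']

theorem fderiv_a_eq_zero {p v : E3} (hp : p ∈ S) (hv : dir p v) :
    fderiv ℝ X.a p v = 0 := by
  obtain ⟨θ, φ, rfl⟩ := X.surj p hp
  obtain ⟨t, -, rfl⟩ := (X.dir_iff θ φ hp v).1 hv
  have hd : HasFDerivAt X.a (fderiv ℝ X.a (X.Ψ θ φ)) (X.Ψ θ φ) :=
    ((X.a_contDiffOn.contDiffAt (X.U_open.mem_nhds (X.U_subset hp))).differentiableAt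
      one_ne_zero).hasFDerivAt
  have h1 := hd.comp_hasDerivAt φ (X.hasDerivAt_right θ φ)
  have h2 : (X.a ∘ fun t => X.Ψ θ t) = fun _ => Real.arcsin (X.k * Real.cos θ) :=
    funext fun t => X.a_eq θ t
  rw [h2] at h1
  rw [map_smul, h1.unique (hasDerivAt_const φ _), smul_zero]

/-- The differential of `a` kills the direction field, so `a` is constant along every integral
curve. -/
theorem a_eq_of_mem_lineThrough {p q : E3} (h : q ∈ lineThrough S dir p) : X.a q = X.a p := by
  obtain ⟨r, s, c, hc, hcS, ⟨t₁, ht₁, rfl⟩, ⟨t₂, ht₂, rfl⟩⟩ := h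
  have hder : ∀ t ∈ Ioo r s, HasDerivAt (X.a ∘ c) 0 t := by
    intro t ht
    obtain ⟨hS, hdir⟩ := hcS t ht
    have h1 : HasDerivAt c (deriv c t) t :=
      ((hc.contDiffAt (isOpen_Ioo.mem_nhds ht)).differentiableAt one_ne_zero).hasDerivAt
    have h2 : HasFDerivAt X.a (fderiv ℝ X.a (c t)) (c t) :=
      ((X.a_contDiffOn.contDiffAt (X.U_open.mem_nhds (X.U_subset hS))).differentiableAt
        one_ne_zero).hasFDerivAt
    have h3 := h2.comp_hasDerivAt t h1
    rwa [X.fderiv_a_eq_zero hS hdir] at h3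
  exact isOpen_Ioo.is_const_of_deriv_eq_zero isPreconnected_Ioo
    (fun t ht => (hder t ht).differentiableAt.differentiableWithinAt)
    (fun t ht => (hder t ht).deriv) ht₂ ht₁

theorem mem_lineThrough_right {θ r s φ φ' : ℝ} (hS : ∀ t ∈ Ioo r s, X.Ψ θ t ∈ S)
    (hφ : φ ∈ Ioo r s) (hφ' : φ' ∈ Ioo r s) : X.Ψ θ φ' ∈ lineThrough S dir (X.Ψ θ φ) := by
  refine ⟨r, s, fun t => X.Ψ θ t, (X.contDiff_right θ).contDiffOn, fun t ht => ⟨hS t ht, ?_⟩,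
    ⟨φ, hφ, rfl⟩, ⟨φ', hφ', rfl⟩⟩
  rw [X.dir_iff θ t (hS t ht), (X.hasDerivAt_right θ t).deriv]
  exact ⟨1, one_ne_zero, (one_smul ℝ _).symm⟩

/-- On `sin θ = 0` the parameters `φ` and `-φ` give the same point: the closed curve is folded onto
an arc, on which `arccos (cos φ)` is the parameter in `[0, π]`. -/
theorem eq_arccos_of_sin_eq_zero {θ φ : ℝ} (hθ : Real.sin θ = 0) :
    X.Ψ θ φ = X.Ψ θ (Real.arccos (Real.cos φ)) := by
  have hcos := Real.cos_arccos (Real.neg_one_le_cos φ) (Real.cos_le_one φ)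
  have hsq : Real.sin (Real.arccos (Real.cos φ)) ^ 2 = Real.sin φ ^ 2 := by
    rw [Real.sin_sq, Real.sin_sq, hcos]
  rcases sq_eq_sq_iff_eq_or_eq_neg.1 hsq with h | h
  · exact X.congr_right θ _ _ hcos.symm h.symm
  · rw [← X.neg_neg θ φ, X.congr_left (-θ) θ (-φ) (Real.cos_neg θ)
      (by rw [Real.sin_neg, hθ, neg_zero])]
    exact X.congr_right θ _ _ (by rw [Real.cos_neg, hcos]) (by rw [Real.sin_neg, h])

/-- Each level set of `a` in `S` is a single connected integral curve. Thus lying on a common curve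
becomes equality of one function, the form in which the net and diagonal properties are proved. -/
theorem mem_lineThrough_iff {p q : E3} (hp : p ∈ S) :
    q ∈ lineThrough S dir p ↔ q ∈ S ∧ X.a q = X.a p := by
  constructor
  · intro h
    refine ⟨?_, X.a_eq_of_mem_lineThrough h⟩
    obtain ⟨r, s, c, -, hcS, -, ⟨t, ht, rfl⟩⟩ := h
    exact (hcS t ht).1
  · rintro ⟨hq, ha⟩
    obtain ⟨θ, φ, rfl⟩ := X.surj p hp
    obtain ⟨θ', φ', rfl⟩ := X.surj q hq
    rw [X.a_eq_iff] at ha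
    obtain ⟨ψ, hψ⟩ : ∃ ψ, X.Ψ θ' φ' = X.Ψ θ ψ := by
      have hsq : Real.sin θ' ^ 2 = Real.sin θ ^ 2 := by rw [Real.sin_sq, Real.sin_sq, ha]
      rcases sq_eq_sq_iff_eq_or_eq_neg.1 hsq with h | h
      · exact ⟨φ', X.congr_left _ _ _ ha h⟩
      -- The two signs of `sin θ` give the same curve, since `Ψ (-θ) (-φ) = Ψ θ φ`.
      · refine ⟨-φ', ?_⟩
        rw [← X.neg_neg θ' φ']
        exact X.congr_left _ _ _ (by rw [Real.cos_neg, ha]) (by rw [Real.sin_neg, h, _root_.neg_neg])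
    rw [hψ] at hq ⊢
    -- For `sin θ = 0` the curve must avoid the branch points, and the folding moves both parameters
    -- into the open interval `(0, π)`. Otherwise the whole line of parameters stays in `S`.
    by_cases hθ : Real.sin θ = 0
    · have hIoo : ∀ t, X.Ψ θ t ∈ S → Real.arccos (Real.cos t) ∈ Ioo 0 Real.pi := by
        intro t ht
        have hs : Real.sin t ≠ 0 := fun h => (X.mem_iff θ t).1 ht ⟨hθ, h⟩
        have h1 := Real.sin_sq_add_cos_sq t
        have h2 : 0 < Real.sin t ^ 2 := by positivity
        refine ⟨Real.arccos_pos.2 ?_, lt_of_le_of_ne (Real.arccos_le_pi _) fun h => ?_⟩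
        · nlinarith
        · rw [Real.arccos_eq_pi] at h
          nlinarith [Real.neg_one_le_cos t]
      rw [X.eq_arccos_of_sin_eq_zero hθ (φ := φ)] at hp ⊢
      rw [X.eq_arccos_of_sin_eq_zero hθ (φ := ψ)] at hq ⊢
      have e1 := hIoo _ hp
      have e2 := hIoo _ hq
      rw [Real.cos_arccos (Real.neg_one_le_cos _) (Real.cos_le_one _)] at e1 e2
      refine X.mem_lineThrough_right (fun t ht => ?_) e1 e2
      rw [X.mem_iff]
      exact fun h => (Real.sin_pos_of_pos_of_lt_pi ht.1 ht.2).ne' h.2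
    · refine X.mem_lineThrough_right (r := min φ ψ - 1) (s := max φ ψ + 1)
        (fun t _ => (X.mem_iff θ t).2 fun h => hθ h.1) ?_ ?_
      · constructor <;> linarith [min_le_left φ ψ, le_max_left φ ψ]
      · constructor <;> linarith [min_le_right φ ψ, le_max_right φ ψ]

theorem exists_mem_iff {x y : E3} :
    (∃ C ∈ lineThrough S dir '' S, x ∈ C ∧ y ∈ C) ↔ x ∈ S ∧ y ∈ S ∧ X.a x = X.a y := by
  constructor
  · rintro ⟨_, ⟨p, hp, rfl⟩, hx, hy⟩
    rw [X.mem_lineThrough_iff hp] at hx hy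
    exact ⟨hx.1, hy.1, hx.2.trans hy.2.symm⟩
  · rintro ⟨hx, hy, h⟩
    exact ⟨_, mem_image_of_mem _ hx, (X.mem_lineThrough_iff hx).2 ⟨hx, rfl⟩,
      (X.mem_lineThrough_iff hx).2 ⟨hy, h.symm⟩⟩

theorem fderiv_a_ne_zero {θ φ : ℝ} (hS : X.Ψ θ φ ∈ S) (hθ : Real.sin θ ≠ 0) :
    fderiv ℝ X.a (X.Ψ θ φ) (X.Ψθ θ φ) ≠ 0 := by
  have hd : HasFDerivAt X.a (fderiv ℝ X.a (X.Ψ θ φ)) (X.Ψ θ φ) :=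
    ((X.a_contDiffOn.contDiffAt (X.U_open.mem_nhds (X.U_subset hS))).differentiableAt
      one_ne_zero).hasFDerivAt
  have h1 := hd.comp_hasDerivAt θ (X.hasDerivAt_left θ φ)
  have h2 : (X.a ∘ fun t => X.Ψ t φ) = Real.arcsin ∘ fun t => X.k * Real.cos t :=
    funext fun t => X.a_eq t φ
  rw [h2] at h1
  have hlt := abs_lt.1 (X.abs_k_mul_cos_lt θ)
  have h3 := (Real.hasDerivAt_arcsin hlt.1.ne' hlt.2.ne).comp θ
    ((Real.hasDerivAt_cos θ).const_mul X.k)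
  rw [h1.unique h3]
  have hsq : 0 < 1 - (X.k * Real.cos θ) ^ 2 := by nlinarith
  have := (Real.sqrt_pos.2 hsq).ne'
  have := X.k_pos.ne'
  simp_all

theorem fderiv_g_ne_zero {θ φ : ℝ} (hS : X.Ψ θ φ ∈ S) (hθ : Real.sin θ = 0)
    (hφ : Real.sin φ ≠ 0) : fderiv ℝ X.g (X.Ψ θ φ) (X.Ψθ θ φ) ≠ 0 := by
  have hd : HasFDerivAt X.g (fderiv ℝ X.g (X.Ψ θ φ)) (X.Ψ θ φ) :=
    ((X.g_contDiffOn.contDiffAt (X.V_open.mem_nhds ((X.mem_V_iff θ φ hS).2 hφ))).differentiableAt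
      one_ne_zero).hasFDerivAt
  have h1 := hd.comp_hasDerivAt θ (X.hasDerivAt_left θ φ)
  have h2 : (X.g ∘ fun t => X.Ψ t φ) =
      fun t => Real.sin t * (Real.sin φ / |Real.sin φ|) := funext fun t => X.g_eq t φ hφ
  rw [h2] at h1
  rw [h1.unique ((Real.hasDerivAt_sin θ).mul_const _)]
  refine mul_ne_zero (fun h => ?_) (div_ne_zero hφ (abs_ne_zero.2 hφ))
  have := Real.sin_sq_add_cos_sq θ
  rw [hθ, h] at this
  norm_num at this

/-- The integral curves of the direction field foliate the surface. -/
theorem foliates (X : CurveChart F S dir) : Foliates F S (lineThrough S dir '' S) := by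
  refine ⟨?_, ?_, ?_⟩
  · rintro _ ⟨p, hp, rfl⟩
    exact ⟨⟨p, (X.mem_lineThrough_iff hp).2 ⟨hp, rfl⟩⟩,
      fun q hq => ((X.mem_lineThrough_iff hp).1 hq).1⟩
  · intro p hp
    refine ⟨lineThrough S dir p, ⟨mem_image_of_mem _ hp, (X.mem_lineThrough_iff hp).2 ⟨hp, rfl⟩⟩, ?_⟩
    rintro _ ⟨⟨q, hq, rfl⟩, hpq⟩
    have h := ((X.mem_lineThrough_iff hq).1 hpq).2
    ext x
    rw [X.mem_lineThrough_iff hq, X.mem_lineThrough_iff hp, h]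
  · intro p hp
    obtain ⟨θ, φ, rfl⟩ := X.surj p hp
    -- At `sin θ = 0` the function `a` is critical in the direction transverse to the curve, so `g =
    -- ± sin θ` is used instead. It determines `cos θ` up to sign, and the restriction to points
    -- where `a` has the sign of its value at `p` removes this ambiguity. Nearby curves can run
    -- along both sides of the folded arc with opposite values of `g`; on the arc itself `g = 0`.
    by_cases hθ : Real.sin θ = 0
    · have hφ : Real.sin φ ≠ 0 := fun h => (X.mem_iff θ φ).1 hp ⟨hθ, h⟩
      have hcos : Real.cos θ ^ 2 = 1 := by
        have := Real.sin_sq_add_cos_sq θ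
        rw [hθ] at this
        linarith
      have ha0 : X.a (X.Ψ θ φ) ≠ 0 := by
        rw [X.a_eq, Ne, Real.arcsin_eq_zero_iff, mul_eq_zero, not_or]
        exact ⟨X.k_pos.ne', fun h => by rw [h] at hcos; norm_num at hcos⟩
      have hcs : ∀ x ∈ S ∩ (X.V ∩ {x | 0 < X.a x * X.a (X.Ψ θ φ)}),
          ∃ θ' φ', X.Ψ θ' φ' = x ∧ X.g x ^ 2 = Real.sin θ' ^ 2 := by
        rintro x ⟨hx, hxV, -⟩
        obtain ⟨θ', φ', rfl⟩ := X.surj x hx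
        have hφ' := (X.mem_V_iff θ' φ' hx).1 hxV
        refine ⟨θ', φ', rfl, ?_⟩
        rw [X.g_eq _ _ hφ', mul_pow, div_pow, sq_abs, div_self (pow_ne_zero 2 hφ'), mul_one]
      refine ⟨X.V ∩ {x | 0 < X.a x * X.a (X.Ψ θ φ)}, X.g, X.V_open.inter
        (isOpen_lt continuous_const (X.a_continuous.mul continuous_const)),
        ⟨(X.mem_V_iff θ φ hp).2 hφ, mul_self_pos.2 ha0⟩, X.g_contDiffOn.mono inter_subset_left,
        ⟨_, X.mem_tangentSpace θ φ hp, X.fderiv_g_ne_zero hp hθ hφ⟩, ?_, ?_⟩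
      · intro x hx y hy hxy
        refine X.exists_mem_iff.2 ⟨hx.1, hy.1, ?_⟩
        obtain ⟨θ₁, φ₁, rfl, h₁⟩ := hcs x hx
        obtain ⟨θ₂, φ₂, rfl, h₂⟩ := hcs y hy
        have h3 : Real.cos θ₁ ^ 2 = Real.cos θ₂ ^ 2 := by
          rw [Real.cos_sq', Real.cos_sq', ← h₁, ← h₂, hxy]
        rcases sq_eq_sq_iff_eq_or_eq_neg.1 h3 with h | h
        · rw [X.a_eq_iff, h]
        · have e : X.a (X.Ψ θ₁ φ₁) = -X.a (X.Ψ θ₂ φ₂) := by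
            rw [X.a_eq, X.a_eq, h, mul_neg, Real.arcsin_neg]
          have h4 : 0 < X.a (X.Ψ θ₁ φ₁) * X.a (X.Ψ θ φ) := hx.2.2
          have h5 : 0 < X.a (X.Ψ θ₂ φ₂) * X.a (X.Ψ θ φ) := hy.2.2
          rw [e] at h4
          linarith
      · intro x hx hC
        obtain ⟨-, -, h⟩ := X.exists_mem_iff.1 hC
        obtain ⟨θ₁, φ₁, rfl, h₁⟩ := hcs x hx
        rw [X.a_eq_iff] at h
        rw [Real.sin_sq, h, hcos, sub_self, sq_eq_zero_iff] at h₁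
        rw [h₁, X.g_eq _ _ hφ, hθ, zero_mul]
    · exact ⟨X.U, X.a, X.U_open, X.U_subset hp, X.a_contDiffOn,
        ⟨_, X.mem_tangentSpace θ φ hp, X.fderiv_a_ne_zero hp hθ⟩,
        fun x hx y hy h => X.exists_mem_iff.2 ⟨hx.1, hy.1, h⟩,
        fun x _ h => (X.exists_mem_iff.1 h).2.2⟩

end CurveChart

/-! ### Sphero-conal coordinates -/

/-- Sphero-conal parametrization of the unit sphere. -/
def sphereParam (k l θ φ : ℝ) : E3 :=
  !₂[Real.cos θ * √(1 - (l * Real.cos φ) ^ 2), Real.sin θ * Real.sin φ,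
    Real.cos φ * √(1 - (k * Real.cos θ) ^ 2)]

/-- The derivative of `sphereParam` with respect to its first variable. -/
def sphereParamLeft (k l θ φ : ℝ) : E3 :=
  !₂[-Real.sin θ * √(1 - (l * Real.cos φ) ^ 2), Real.cos θ * Real.sin φ,
    Real.cos φ * (k ^ 2 * Real.cos θ * Real.sin θ / √(1 - (k * Real.cos θ) ^ 2))]

/-- The derivative of `sphereParam` with respect to its second variable. -/
def sphereParamRight (k l θ φ : ℝ) : E3 :=
  !₂[Real.cos θ * (l ^ 2 * Real.cos φ * Real.sin φ / √(1 - (l * Real.cos φ) ^ 2)),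
    Real.sin θ * Real.cos φ, -Real.sin φ * √(1 - (k * Real.cos θ) ^ 2)]

theorem hasDerivAt_E3 {x y z : ℝ → ℝ} {x' y' z' t : ℝ} (hx : HasDerivAt x x' t)
    (hy : HasDerivAt y y' t) (hz : HasDerivAt z z' t) :
    HasDerivAt (fun s => (!₂[x s, y s, z s] : E3)) !₂[x', y', z'] t := by
  have h := ((hx.smul_const (EuclideanSpace.single 0 1 : E3)).add
    (hy.smul_const (EuclideanSpace.single 1 1 : E3))).add
    (hz.smul_const (EuclideanSpace.single 2 1 : E3))
  have hf : (fun s => (!₂[x s, y s, z s] : E3)) =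
      ((fun s => x s • (EuclideanSpace.single 0 1 : E3)) +
        fun s => y s • (EuclideanSpace.single 1 1 : E3)) +
        fun s => z s • (EuclideanSpace.single 2 1 : E3) := by
    funext s
    apply E3.ext <;> simp
  rw [hf]
  refine h.congr_deriv ?_
  apply E3.ext <;> simp

theorem one_sub_mul_cos_sq_pos {k : ℝ} (hk : k ^ 2 < 1) (θ : ℝ) :
    0 < 1 - (k * Real.cos θ) ^ 2 := by
  have h1 := Real.sin_sq_add_cos_sq θ
  rw [mul_pow]
  nlinarith [sq_nonneg (Real.sin θ), sq_nonneg k, mul_nonneg (sq_nonneg k) (sq_nonneg (Real.sin θ))]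

theorem hasDerivAt_sqrt_one_sub {k : ℝ} (hk : k ^ 2 < 1) (θ : ℝ) :
    HasDerivAt (fun t => √(1 - (k * Real.cos t) ^ 2))
      (k ^ 2 * Real.cos θ * Real.sin θ / √(1 - (k * Real.cos θ) ^ 2)) θ := by
  have h := one_sub_mul_cos_sq_pos hk θ
  have h1 := ((((Real.hasDerivAt_cos θ).const_mul k).pow 2).const_sub 1).sqrt h.ne'
  refine h1.congr_deriv ?_
  have := (Real.sqrt_pos.2 h).ne'
  simp only [Pi.pow_apply]
  field_simp
  ring

theorem contDiff_sqrt_one_sub {k : ℝ} (hk : k ^ 2 < 1) :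
    ContDiff ℝ 1 fun t => √(1 - (k * Real.cos t) ^ 2) :=
  (contDiff_const.sub ((contDiff_const.mul Real.contDiff_cos).pow 2)).sqrt
    fun t => (one_sub_mul_cos_sq_pos hk t).ne'

/-- The condition `x² + y² ≤ 1` keeps the sum of the angles on the principal branch, as the addition
theorem below requires. -/
theorem arcsin_add_arcsin_le {x y : ℝ} (h : x ^ 2 + y ^ 2 ≤ 1) :
    Real.arcsin x + Real.arcsin y ≤ Real.pi / 2 := by
  by_cases hx : Real.arcsin x ≤ 0
  · linarith [Real.arcsin_le_pi_div_two y]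
  push Not at hx
  have h1 : Real.arcsin y ≤ Real.pi / 2 - Real.arcsin x := by
    rw [Real.arcsin_le_iff_le_sin' ⟨by linarith [Real.arcsin_le_pi_div_two x, Real.pi_pos],
      by linarith⟩, Real.sin_pi_div_two_sub, Real.cos_arcsin]
    exact Real.le_sqrt_of_sq_le (by linarith)
  linarith

theorem arcsin_sin_add {x y : ℝ} (h : x ^ 2 + y ^ 2 ≤ 1) :
    Real.arcsin (x * √(1 - y ^ 2) + y * √(1 - x ^ 2)) = Real.arcsin x + Real.arcsin y := by
  have hx := abs_le.1 ((sq_le_one_iff_abs_le_one x).1 (by linarith [sq_nonneg y]))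
  have hy := abs_le.1 ((sq_le_one_iff_abs_le_one y).1 (by linarith [sq_nonneg x]))
  have h1 := arcsin_add_arcsin_le h
  have h2 := arcsin_add_arcsin_le (x := -x) (y := -y) (by linarith)
  rw [Real.arcsin_neg, Real.arcsin_neg] at h2
  rw [← Real.arcsin_sin (x := Real.arcsin x + Real.arcsin y) (by linarith) h1, Real.sin_add,
    Real.sin_arcsin hx.1 hx.2, Real.sin_arcsin hy.1 hy.2, Real.cos_arcsin, Real.cos_arcsin,
    mul_comm y]

theorem arcsin_sin_sub {x y : ℝ} (h : x ^ 2 + y ^ 2 ≤ 1) :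
    Real.arcsin (x * √(1 - y ^ 2) - y * √(1 - x ^ 2)) = Real.arcsin x - Real.arcsin y := by
  have := arcsin_sin_add (x := x) (y := -y) (by linarith)
  rwa [Real.arcsin_neg, neg_sq, neg_mul, ← sub_eq_add_neg, ← sub_eq_add_neg] at this

section SphereParam

variable {k l : ℝ}

theorem sphereParam_congr_left {θ θ' : ℝ} (φ : ℝ) (h1 : Real.cos θ = Real.cos θ')
    (h2 : Real.sin θ = Real.sin θ') : sphereParam k l θ φ = sphereParam k l θ' φ := by
  rw [sphereParam, sphereParam, h1, h2]

theorem sphereParam_congr_right (θ : ℝ) {φ φ' : ℝ} (h1 : Real.cos φ = Real.cos φ')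
    (h2 : Real.sin φ = Real.sin φ') : sphereParam k l θ φ = sphereParam k l θ φ' := by
  rw [sphereParam, sphereParam, h1, h2]

theorem sphereParam_neg_neg (θ φ : ℝ) : sphereParam k l (-θ) (-φ) = sphereParam k l θ φ := by
  simp [sphereParam]

variable (hkl : k ^ 2 + l ^ 2 = 1) (hk : 0 < k) (hl : 0 < l)
include hkl hk hl

omit hk in
theorem hasDerivAt_sphereParam_left (θ φ : ℝ) :
    HasDerivAt (fun t => sphereParam k l t φ) (sphereParamLeft k l θ φ) θ :=
  hasDerivAt_E3 ((Real.hasDerivAt_cos θ).mul_const _) ((Real.hasDerivAt_sin θ).mul_const _)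
    ((hasDerivAt_sqrt_one_sub (by nlinarith) θ).const_mul _)

omit hl in
theorem hasDerivAt_sphereParam_right (θ φ : ℝ) :
    HasDerivAt (fun t => sphereParam k l θ t) (sphereParamRight k l θ φ) φ :=
  hasDerivAt_E3 ((hasDerivAt_sqrt_one_sub (by nlinarith) φ).const_mul _)
    ((Real.hasDerivAt_sin φ).const_mul _) ((Real.hasDerivAt_cos φ).mul_const _)

omit hk in
theorem contDiff_sphereParam_left (φ : ℝ) : ContDiff ℝ 1 (fun t => sphereParam k l t φ) := by
  rw [contDiff_euclidean]
  intro i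
  fin_cases i
  · exact Real.contDiff_cos.mul contDiff_const
  · exact Real.contDiff_sin.mul contDiff_const
  · exact contDiff_const.mul (contDiff_sqrt_one_sub (by nlinarith))

omit hl in
theorem contDiff_sphereParam_right (θ : ℝ) : ContDiff ℝ 1 (fun t => sphereParam k l θ t) := by
  rw [contDiff_euclidean]
  intro i
  fin_cases i
  · exact contDiff_const.mul (contDiff_sqrt_one_sub (by nlinarith))
  · exact contDiff_const.mul Real.contDiff_sin
  · exact Real.contDiff_cos.mul contDiff_const

theorem sphereParam_trig (θ φ : ℝ) :
    ∃ Q R, √(1 - (k * Real.cos θ) ^ 2) = Q ∧ √(1 - (l * Real.cos φ) ^ 2) = R ∧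
      Q ^ 2 = 1 - k ^ 2 * Real.cos θ ^ 2 ∧ R ^ 2 = 1 - l ^ 2 * Real.cos φ ^ 2 ∧
      0 < Q ∧ 0 < R := by
  have h1 := one_sub_mul_cos_sq_pos (k := k) (by nlinarith) θ
  have h2 := one_sub_mul_cos_sq_pos (k := l) (by nlinarith) φ
  exact ⟨_, _, rfl, rfl, by rw [Real.sq_sqrt h1.le, mul_pow],
    by rw [Real.sq_sqrt h2.le, mul_pow], Real.sqrt_pos.2 h1, Real.sqrt_pos.2 h2⟩

theorem sphereParam_norm_sq (θ φ : ℝ) : ‖sphereParam k l θ φ‖ ^ 2 = 1 := by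
  obtain ⟨Q, R, hQe, hRe, hQ, hR, -, -⟩ := sphereParam_trig hkl hk hl θ φ
  rw [E3.norm_sq_eq]
  simp only [sphereParam, PiLp.toLp_apply, Matrix.cons_val_zero, Matrix.cons_val_one,
    Matrix.cons_val, hQe, hRe]
  rw [mul_pow, mul_pow, mul_pow, hQ, hR, Real.sin_sq, Real.sin_sq]
  linear_combination (-Real.cos θ ^ 2 * Real.cos φ ^ 2) * hkl

theorem inner_sphereParam_left (θ φ : ℝ) :
    ⟪sphereParam k l θ φ, sphereParamLeft k l θ φ⟫ = 0 := by
  obtain ⟨Q, R, hQe, hRe, hQ, hR, hQ0, hR0⟩ := sphereParam_trig hkl hk hl θ φ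
  rw [E3.inner_eq]
  simp only [sphereParam, sphereParamLeft, PiLp.toLp_apply, Matrix.cons_val_zero,
    Matrix.cons_val_one, Matrix.cons_val, hQe, hRe]
  field_simp
  rw [hR]
  have := Real.sin_sq φ
  linear_combination Real.cos θ * Real.sin θ * this + Real.cos θ * Real.sin θ * Real.cos φ ^ 2 * hkl

theorem inner_sphereParam_right (θ φ : ℝ) :
    ⟪sphereParam k l θ φ, sphereParamRight k l θ φ⟫ = 0 := by
  obtain ⟨Q, R, hQe, hRe, hQ, hR, hQ0, hR0⟩ := sphereParam_trig hkl hk hl θ φ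
  rw [E3.inner_eq]
  simp only [sphereParam, sphereParamRight, PiLp.toLp_apply, Matrix.cons_val_zero,
    Matrix.cons_val_one, Matrix.cons_val, hQe, hRe]
  field_simp
  rw [hQ]
  have := Real.sin_sq θ
  linear_combination Real.cos φ * Real.sin φ * this + Real.cos φ * Real.sin φ * Real.cos θ ^ 2 * hkl

-- The two roots in `sphereParam` are the cosines of `A = arcsin (k cos θ)` and `B = arcsin (l cos
-- φ)`, so `k x ± l z = sin (A ± B)`. The angles stay on the principal branch because `(k cos θ)² +
-- (l cos φ)² ≤ k² + l² = 1`.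
omit hk hl in
theorem arcsin_sphereParam (θ φ : ℝ) :
    Real.arcsin (k * sphereParam k l θ φ 0 + l * sphereParam k l θ φ 2) =
      Real.arcsin (k * Real.cos θ) + Real.arcsin (l * Real.cos φ) ∧
    Real.arcsin (k * sphereParam k l θ φ 0 - l * sphereParam k l θ φ 2) =
      Real.arcsin (k * Real.cos θ) - Real.arcsin (l * Real.cos φ) := by
  have h : (k * Real.cos θ) ^ 2 + (l * Real.cos φ) ^ 2 ≤ 1 := by
    rw [mul_pow, mul_pow]
    nlinarith [Real.cos_sq_le_one θ, Real.cos_sq_le_one φ, sq_nonneg k, sq_nonneg l]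
  rw [← arcsin_sin_add h, ← arcsin_sin_sub h]
  simp only [sphereParam, PiLp.toLp_apply, Matrix.cons_val_zero, Matrix.cons_val]
  constructor <;> congr 1 <;> ring

/-- The angles `a` and `b` are recovered as half the sum and half the difference of `arcsin (k x ± l
z)`; it remains to show that `sin a / k` and `sin b / l` are cosines. -/
theorem exists_sphereParam_eq {v : E3} (hv : ‖v‖ ^ 2 = 1) :
    ∃ θ φ, sphereParam k l θ φ = v := by
  rw [E3.norm_sq_eq] at hv
  have hP : (k * v 0 + l * v 2) ^ 2 ≤ 1 := by
    nlinarith [sq_nonneg (l * v 0 - k * v 2), sq_nonneg (v 1)]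
  have hM : (k * v 0 - l * v 2) ^ 2 ≤ 1 := by
    nlinarith [sq_nonneg (l * v 0 + k * v 2), sq_nonneg (v 1)]
  have hP' := abs_le.1 ((sq_le_one_iff_abs_le_one _).1 hP)
  have hM' := abs_le.1 ((sq_le_one_iff_abs_le_one _).1 hM)
  obtain ⟨s, hs⟩ : ∃ s, s = Real.arcsin (k * v 0 + l * v 2) := ⟨_, rfl⟩
  obtain ⟨t, ht⟩ : ∃ t, t = Real.arcsin (k * v 0 - l * v 2) := ⟨_, rfl⟩
  obtain ⟨a, ha⟩ : ∃ a, a = (s + t) / 2 := ⟨_, rfl⟩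
  obtain ⟨b, hb⟩ : ∃ b, b = (s - t) / 2 := ⟨_, rfl⟩
  have hsP : Real.sin (a + b) = k * v 0 + l * v 2 := by
    rw [show a + b = s by rw [ha, hb]; ring, hs, Real.sin_arcsin hP'.1 hP'.2]
  have hsM : Real.sin (a - b) = k * v 0 - l * v 2 := by
    rw [show a - b = t by rw [ha, hb]; ring, ht, Real.sin_arcsin hM'.1 hM'.2]
  have hcP : 0 ≤ Real.cos (a + b) := by
    rw [show a + b = s by rw [ha, hb]; ring, hs]; exact Real.cos_arcsin_nonneg _
  have hcM : 0 ≤ Real.cos (a - b) := by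
    rw [show a - b = t by rw [ha, hb]; ring, ht]; exact Real.cos_arcsin_nonneg _
  have hca : 0 ≤ Real.cos a := Real.cos_nonneg_of_neg_pi_div_two_le_of_le
    (by rw [ha, hs, ht]; linarith [Real.neg_pi_div_two_le_arcsin (k * v 0 + l * v 2),
      Real.neg_pi_div_two_le_arcsin (k * v 0 - l * v 2)])
    (by rw [ha, hs, ht]; linarith [Real.arcsin_le_pi_div_two (k * v 0 + l * v 2),
      Real.arcsin_le_pi_div_two (k * v 0 - l * v 2)])
  have hcb : 0 ≤ Real.cos b := Real.cos_nonneg_of_neg_pi_div_two_le_of_le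
    (by rw [hb, hs, ht]; linarith [Real.neg_pi_div_two_le_arcsin (k * v 0 + l * v 2),
      Real.arcsin_le_pi_div_two (k * v 0 - l * v 2)])
    (by rw [hb, hs, ht]; linarith [Real.arcsin_le_pi_div_two (k * v 0 + l * v 2),
      Real.neg_pi_div_two_le_arcsin (k * v 0 - l * v 2)])
  have hprod := mul_nonneg hcP hcM
  rw [Real.sin_add] at hsP
  rw [Real.sin_sub] at hsM
  rw [Real.cos_add, Real.cos_sub] at hprod
  have h0 : k * v 0 = Real.sin a * Real.cos b := by linarith
  have h2 : l * v 2 = Real.cos a * Real.sin b := by linarith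
  have ha2 := Real.sin_sq_add_cos_sq a
  have hb2 := Real.sin_sq_add_cos_sq b
  -- This is `0 ≤ cos (a + b) cos (a - b) = 1 - sin² a - sin² b`.
  have hsum : Real.sin a ^ 2 + Real.sin b ^ 2 ≤ 1 := by nlinarith
  obtain ⟨C, hC⟩ : ∃ C, Real.sin a = k * C := ⟨Real.sin a / k, by field_simp⟩
  obtain ⟨c, hc⟩ : ∃ c, Real.sin b = l * c := ⟨Real.sin b / l, by field_simp⟩
  have hv0 : v 0 = C * Real.cos b := by
    apply mul_left_cancel₀ hk.ne'; rw [h0, hC]; ring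
  have hv2 : v 2 = c * Real.cos a := by
    apply mul_left_cancel₀ hl.ne'; rw [h2, hc]; ring
  have hv1 : v 1 ^ 2 = (1 - C ^ 2) * (1 - c ^ 2) := by
    have e1 : Real.cos a ^ 2 = 1 - k ^ 2 * C ^ 2 := by rw [← mul_pow, ← hC]; linarith
    have e2 : Real.cos b ^ 2 = 1 - l ^ 2 * c ^ 2 := by rw [← mul_pow, ← hc]; linarith
    rw [hv0, hv2, mul_pow, mul_pow, e1, e2] at hv
    linear_combination hv + C ^ 2 * c ^ 2 * hkl
  rw [hC, hc, mul_pow, mul_pow] at hsum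
  have hk2 : 0 < k ^ 2 := by positivity
  have hl2 : 0 < l ^ 2 := by positivity
  -- As `(1 - C²)(1 - c²) = (v 1)² ≥ 0`, if one of the squares exceeded 1 the other would be at
  -- least 1, contradicting `k² C² + l² c² ≤ 1 = k² + l²`.
  have hbound : C ^ 2 ≤ 1 ∧ c ^ 2 ≤ 1 := by
    by_contra hcon
    rw [not_and_or, not_le, not_le] at hcon
    have hp : 0 ≤ (1 - C ^ 2) * (1 - c ^ 2) := hv1 ▸ sq_nonneg _
    rcases hcon with h | h
    · have h1 : 1 ≤ c ^ 2 := by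
        by_contra! h1
        linarith [mul_neg_of_neg_of_pos (sub_neg.2 h) (sub_pos.2 h1)]
      linarith [mul_lt_mul_of_pos_left h hk2, mul_le_mul_of_nonneg_left h1 hl2.le]
    · have h1 : 1 ≤ C ^ 2 := by
        by_contra! h1
        linarith [mul_neg_of_pos_of_neg (sub_pos.2 h1) (sub_neg.2 h)]
      linarith [mul_lt_mul_of_pos_left h hl2, mul_le_mul_of_nonneg_left h1 hk2.le]
  have hC1 := abs_le.1 ((sq_le_one_iff_abs_le_one C).1 hbound.1)
  have hc1 := abs_le.1 ((sq_le_one_iff_abs_le_one c).1 hbound.2)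
  have hsq : v 1 ^ 2 = (√(1 - C ^ 2) * √(1 - c ^ 2)) ^ 2 := by
    rw [mul_pow, Real.sq_sqrt (by linarith [hbound.1]), Real.sq_sqrt (by linarith [hbound.2]), hv1]
  have hR : √(1 - (l * c) ^ 2) = Real.cos b := by
    rw [← hc, ← Real.cos_sq', Real.sqrt_sq hcb]
  have hQ : √(1 - (k * C) ^ 2) = Real.cos a := by
    rw [← hC, ← Real.cos_sq', Real.sqrt_sq hca]
  -- The sign of the middle coordinate is absorbed into the sign of `θ`.
  rcases sq_eq_sq_iff_eq_or_eq_neg.1 hsq with h | h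
  · refine ⟨Real.arccos C, Real.arccos c, E3.ext ?_ ?_ ?_⟩ <;>
      simp [sphereParam, Real.cos_arccos hC1.1 hC1.2, Real.cos_arccos hc1.1 hc1.2,
        Real.sin_arccos, hR, hQ, hv0, hv2, h]
  · refine ⟨-Real.arccos C, Real.arccos c, E3.ext ?_ ?_ ?_⟩ <;>
      simp [sphereParam, Real.cos_arccos hC1.1 hC1.2, Real.cos_arccos hc1.1 hc1.2,
        Real.sin_arccos, hR, hQ, hv0, hv2, h]

theorem sphereParam_umbilic_iff (θ φ : ℝ) :
    (sphereParam k l θ φ 1 = 0 ∧ sphereParam k l θ φ 0 ^ 2 = k ^ 2 ∧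
      sphereParam k l θ φ 2 ^ 2 = l ^ 2) ↔ Real.sin θ = 0 ∧ Real.sin φ = 0 := by
  obtain ⟨Q, R, hQe, hRe, hQ, hR, hQ0, hR0⟩ := sphereParam_trig hkl hk hl θ φ
  have hθ := Real.sin_sq_add_cos_sq θ
  have hφ := Real.sin_sq_add_cos_sq φ
  simp only [sphereParam, PiLp.toLp_apply, Matrix.cons_val_zero, Matrix.cons_val_one,
    Matrix.cons_val, hQe, hRe]
  simp only [mul_pow, hQ, hR, mul_eq_zero]
  constructor
  · rintro ⟨h1, h0, h2⟩
    rcases h1 with h | h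
    · refine ⟨h, ?_⟩
      rw [h] at hθ
      have : l ^ 2 * Real.sin φ ^ 2 = 0 := by
        linear_combination h0 - (1 - l ^ 2 * Real.cos φ ^ 2) * hθ + l ^ 2 * hφ + hkl
      simpa [hl.ne'] using this
    · refine ⟨?_, h⟩
      rw [h] at hφ
      have : k ^ 2 * Real.sin θ ^ 2 = 0 := by
        linear_combination h2 - (1 - k ^ 2 * Real.cos θ ^ 2) * hφ + k ^ 2 * hθ + hkl
      simpa [hk.ne'] using this
  · rintro ⟨h1, h2⟩
    rw [h1] at hθ
    rw [h2] at hφ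
    have e1 : Real.cos θ ^ 2 = 1 := by linarith
    have e2 : Real.cos φ ^ 2 = 1 := by linarith
    refine ⟨Or.inl h1, ?_, ?_⟩
    · rw [e1, e2]; linarith
    · rw [e1, e2]; linarith

end SphereParam

/-! ### Lines of curvature of the ellipsoid -/

section Frame

variable {α β γ k l : ℝ} (hkl : k ^ 2 + l ^ 2 = 1) (hk : 0 < k) (hl : 0 < l)
include hkl hk hl

theorem inner_sphereParamRight_left (θ φ : ℝ) :
    ⟪sphereParamRight k l θ φ, sphereParamLeft k l θ φ⟫ = 0 := by
  obtain ⟨Q, R, hQe, hRe, hQ, hR, hQ0, hR0⟩ := sphereParam_trig hkl hk hl θ φ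
  rw [E3.inner_eq]
  simp only [sphereParamRight, sphereParamLeft, PiLp.toLp_apply, Matrix.cons_val_zero,
    Matrix.cons_val_one, Matrix.cons_val, hQe, hRe]
  field_simp
  linear_combination -(Real.cos θ * Real.sin θ * Real.cos φ * Real.sin φ) * hkl

/-- This is orthogonality of the coordinate directions on the ellipsoid; together with orthogonality
on the sphere, which becomes conjugacy, it makes them principal. -/
theorem weighted_inner_sphereParamRight_left (hβ : β = α * l ^ 2 + γ * k ^ 2) (θ φ : ℝ) :
    α * sphereParamRight k l θ φ 0 * sphereParamLeft k l θ φ 0 +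
      β * sphereParamRight k l θ φ 1 * sphereParamLeft k l θ φ 1 +
      γ * sphereParamRight k l θ φ 2 * sphereParamLeft k l θ φ 2 = 0 := by
  obtain ⟨Q, R, hQe, hRe, hQ, hR, hQ0, hR0⟩ := sphereParam_trig hkl hk hl θ φ
  simp only [sphereParamRight, sphereParamLeft, PiLp.toLp_apply, Matrix.cons_val_zero,
    Matrix.cons_val_one, Matrix.cons_val, hQe, hRe]
  field_simp
  rw [hβ]
  ring

theorem norm_sq_sphereParamRight (θ φ : ℝ) :
    ‖sphereParamRight k l θ φ‖ ^ 2 * (1 - l ^ 2 * Real.cos φ ^ 2) =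
      k ^ 2 * Real.sin θ ^ 2 + l ^ 2 * Real.sin φ ^ 2 := by
  obtain ⟨Q, R, hQe, hRe, hQ, hR, hQ0, hR0⟩ := sphereParam_trig hkl hk hl θ φ
  rw [E3.norm_sq_eq]
  simp only [sphereParamRight, PiLp.toLp_apply, Matrix.cons_val_zero,
    Matrix.cons_val_one, Matrix.cons_val, hQe, hRe]
  simp only [mul_pow, div_pow, hQ, neg_sq]
  rw [hR, Real.sin_sq, Real.sin_sq, show k ^ 2 = 1 - l ^ 2 by linarith]
  have : 1 - l ^ 2 * Real.cos φ ^ 2 ≠ 0 := by rw [← hR]; positivity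
  field_simp
  ring

theorem norm_sq_sphereParamLeft (θ φ : ℝ) :
    ‖sphereParamLeft k l θ φ‖ ^ 2 * (1 - k ^ 2 * Real.cos θ ^ 2) =
      k ^ 2 * Real.sin θ ^ 2 + l ^ 2 * Real.sin φ ^ 2 := by
  obtain ⟨Q, R, hQe, hRe, hQ, hR, hQ0, hR0⟩ := sphereParam_trig hkl hk hl θ φ
  rw [E3.norm_sq_eq]
  simp only [sphereParamLeft, PiLp.toLp_apply, Matrix.cons_val_zero,
    Matrix.cons_val_one, Matrix.cons_val, hQe, hRe]
  simp only [mul_pow, div_pow, hR, neg_sq]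
  rw [hQ, Real.sin_sq, Real.sin_sq, show l ^ 2 = 1 - k ^ 2 by linarith]
  have : 1 - k ^ 2 * Real.cos θ ^ 2 ≠ 0 := by rw [← hQ]; positivity
  obtain ⟨Z, hZ⟩ : ∃ Z, Z = 1 - k ^ 2 * Real.cos θ ^ 2 := ⟨_, rfl⟩
  rw [← hZ] at this ⊢
  field_simp
  rw [hZ]
  ring

theorem weighted_norm_sq_sphereParamRight (hβ : β = α * l ^ 2 + γ * k ^ 2) (θ φ : ℝ) :
    α * sphereParamRight k l θ φ 0 ^ 2 + β * sphereParamRight k l θ φ 1 ^ 2 +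
      γ * sphereParamRight k l θ φ 2 ^ 2 =
      (γ * Real.sin φ ^ 2 + β * Real.cos φ ^ 2) * ‖sphereParamRight k l θ φ‖ ^ 2 := by
  obtain ⟨Q, R, hQe, hRe, hQ, hR, hQ0, hR0⟩ := sphereParam_trig hkl hk hl θ φ
  rw [E3.norm_sq_eq]
  simp only [sphereParamRight, PiLp.toLp_apply, Matrix.cons_val_zero,
    Matrix.cons_val_one, Matrix.cons_val, hQe, hRe]
  simp only [mul_pow, div_pow, hQ, neg_sq]
  rw [hR, Real.sin_sq, Real.sin_sq, hβ, show k ^ 2 = 1 - l ^ 2 by linarith]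
  have : 1 - l ^ 2 * Real.cos φ ^ 2 ≠ 0 := by rw [← hR]; positivity
  field_simp
  ring

theorem weighted_norm_sq_sphereParamLeft (hβ : β = α * l ^ 2 + γ * k ^ 2) (θ φ : ℝ) :
    α * sphereParamLeft k l θ φ 0 ^ 2 + β * sphereParamLeft k l θ φ 1 ^ 2 +
      γ * sphereParamLeft k l θ φ 2 ^ 2 =
      (α * Real.sin θ ^ 2 + β * Real.cos θ ^ 2) * ‖sphereParamLeft k l θ φ‖ ^ 2 := by
  obtain ⟨Q, R, hQe, hRe, hQ, hR, hQ0, hR0⟩ := sphereParam_trig hkl hk hl θ φ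
  rw [E3.norm_sq_eq]
  simp only [sphereParamLeft, PiLp.toLp_apply, Matrix.cons_val_zero,
    Matrix.cons_val_one, Matrix.cons_val, hQe, hRe]
  simp only [mul_pow, div_pow, hR, neg_sq]
  rw [hQ, Real.sin_sq, Real.sin_sq, hβ, show l ^ 2 = 1 - k ^ 2 by linarith]
  have : 1 - k ^ 2 * Real.cos θ ^ 2 ≠ 0 := by rw [← hQ]; positivity
  obtain ⟨Z, hZ⟩ : ∃ Z, Z = 1 - k ^ 2 * Real.cos θ ^ 2 := ⟨_, rfl⟩
  rw [← hZ] at this ⊢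
  field_simp
  rw [hZ]
  ring

end Frame

/-- The linear map taking the unit sphere to the ellipsoid. -/
def fromSphere (α β γ : ℝ) : E3 →L[ℝ] E3 := diagMap √α √β √γ

/-- Half the sum (`σ = 1`) or difference (`σ = -1`) of the angular coordinates belonging to the two
families of circular cross sections. -/
def angleCoord (α β γ k l σ : ℝ) (x : E3) : ℝ :=
  (Real.arcsin ⟪conormal α β γ (fromSphere α β γ !₂[k, 0, l]), x⟫ +
    σ * Real.arcsin ⟪conormal α β γ (fromSphere α β γ !₂[k, 0, -l]), x⟫) / 2

/-- The domain of smoothness of the angular coordinates. -/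
def angleDomain (α β γ k l : ℝ) : Set E3 :=
  {x | |⟪conormal α β γ (fromSphere α β γ !₂[k, 0, l]), x⟫| < 1 ∧
    |⟪conormal α β γ (fromSphere α β γ !₂[k, 0, -l]), x⟫| < 1}

/-- The smooth substitute for an angular coordinate near its extremal level curves. -/
def edgeCoord (α β γ k l σ m : ℝ) (x : E3) : ℝ :=
  x 1 / (√β * √(1 - (Real.sin (angleCoord α β γ k l σ x) / m) ^ 2))

/-- The domain of smoothness of `edgeCoord`. -/
def edgeDomain (α β γ k l σ m : ℝ) : Set E3 :=
  angleDomain α β γ k l ∩ {x | (Real.sin (angleCoord α β γ k l σ x) / m) ^ 2 < 1}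

/-! ### Smoothness of the angular coordinates and transport of metric and conjugacy from the sphere
-/

section FromSphere

variable {α β γ k l : ℝ}

theorem continuous_angleCoord (σ : ℝ) : Continuous (angleCoord α β γ k l σ) := by
  unfold angleCoord
  exact ((Real.continuous_arcsin.comp (by fun_prop)).add
    (continuous_const.mul (Real.continuous_arcsin.comp (by fun_prop)))).div_const _

theorem isOpen_angleDomain : IsOpen (angleDomain α β γ k l) :=
  (isOpen_lt (continuous_const.inner continuous_id).abs continuous_const).and
    (isOpen_lt (continuous_const.inner continuous_id).abs continuous_const)

theorem contDiffOn_angleCoord (σ : ℝ) :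
    ContDiffOn ℝ 1 (angleCoord α β γ k l σ) (angleDomain α β γ k l) := by
  intro x hx
  have h1 := abs_lt.1 hx.1
  have h2 := abs_lt.1 hx.2
  have e1 : ContDiffAt ℝ 1
      (fun y => ⟪conormal α β γ (fromSphere α β γ !₂[k, 0, l]), y⟫) x :=
    contDiffAt_const.inner ℝ contDiffAt_id
  have e2 : ContDiffAt ℝ 1
      (fun y => ⟪conormal α β γ (fromSphere α β γ !₂[k, 0, -l]), y⟫) x :=
    contDiffAt_const.inner ℝ contDiffAt_id
  exact ((((Real.contDiffAt_arcsin h1.1.ne' h1.2.ne).comp x e1).add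
    (contDiffAt_const.mul ((Real.contDiffAt_arcsin h2.1.ne' h2.2.ne).comp x e2))).div_const
      2).contDiffWithinAt

theorem isOpen_edgeDomain (σ m : ℝ) : IsOpen (edgeDomain α β γ k l σ m) :=
  isOpen_angleDomain.inter (isOpen_lt
    (((Real.continuous_sin.comp (continuous_angleCoord σ)).div_const _).pow 2) continuous_const)

theorem contDiffOn_edgeCoord (hβ : 0 < β) (σ m : ℝ) :
    ContDiffOn ℝ 1 (edgeCoord α β γ k l σ m) (edgeDomain α β γ k l σ m) := by
  have h1 : ContDiffOn ℝ 1
      (fun x => 1 - (Real.sin (angleCoord α β γ k l σ x) / m) ^ 2)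
      (edgeDomain α β γ k l σ m) :=
    contDiffOn_const.sub (((Real.contDiff_sin.comp_contDiffOn
      ((contDiffOn_angleCoord σ).mono inter_subset_left)).div_const m).pow 2)
  have h0 : ∀ x ∈ edgeDomain α β γ k l σ m,
      0 < 1 - (Real.sin (angleCoord α β γ k l σ x) / m) ^ 2 := fun x hx => sub_pos.2 hx.2
  have h2 : ContDiffOn ℝ 1 (fun x : E3 => x 1) (edgeDomain α β γ k l σ m) := by fun_prop
  exact h2.div (contDiffOn_const.mul (h1.sqrt fun x hx => (h0 x hx).ne'))
    fun x hx => (mul_pos (Real.sqrt_pos.2 hβ) (Real.sqrt_pos.2 (h0 x hx))).ne'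

variable (hα : 0 < α) (hβ : 0 < β) (hγ : 0 < γ)
include hα hβ hγ

theorem inner_conormal_fromSphere (v w : E3) :
    ⟪conormal α β γ (fromSphere α β γ v), fromSphere α β γ w⟫ = ⟪v, w⟫ := by
  rw [inner_conormal, E3.inner_eq]
  simp only [fromSphere, diagMap_apply_zero, diagMap_apply_one, diagMap_apply_two]
  have h : ∀ {c : ℝ}, 0 < c → ∀ x y : ℝ, √c * x * (√c * y) / c = x * y := by
    intro c hc x y
    rw [mul_mul_mul_comm, Real.mul_self_sqrt hc.le]
    field_simp
  rw [h hα, h hβ, h hγ]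

theorem ellipsoidForm_fromSphere (v : E3) :
    ellipsoidForm α β γ (fromSphere α β γ v) = ‖v‖ ^ 2 := by
  rw [ellipsoidForm_eq_inner, inner_conormal_fromSphere hα hβ hγ, real_inner_self_eq_norm_sq]

theorem inner_fromSphere (v w : E3) :
    ⟪fromSphere α β γ v, fromSphere α β γ w⟫ =
      α * v 0 * w 0 + β * v 1 * w 1 + γ * v 2 * w 2 := by
  rw [E3.inner_eq]
  simp only [fromSphere, diagMap_apply_zero, diagMap_apply_one, diagMap_apply_two]
  have h : ∀ {c : ℝ}, 0 < c → ∀ x y : ℝ, √c * x * (√c * y) = c * x * y := by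
    intro c hc x y
    rw [mul_mul_mul_comm, Real.mul_self_sqrt hc.le, mul_assoc]
  rw [h hα, h hβ, h hγ]

theorem norm_sq_fromSphere (v : E3) :
    ‖fromSphere α β γ v‖ ^ 2 = α * v 0 ^ 2 + β * v 1 ^ 2 + γ * v 2 ^ 2 := by
  rw [← real_inner_self_eq_norm_sq, inner_fromSphere hα hβ hγ]
  ring

theorem exists_fromSphere_eq (p : E3) : ∃ v, fromSphere α β γ v = p := by
  refine ⟨diagMap (√α)⁻¹ (√β)⁻¹ (√γ)⁻¹ p, ?_⟩
  have h1 := (Real.sqrt_pos.2 hα).ne'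
  have h2 := (Real.sqrt_pos.2 hβ).ne'
  have h3 := (Real.sqrt_pos.2 hγ).ne'
  apply E3.ext <;> simp [fromSphere, h1, h2, h3]

theorem fromSphere_ne_zero {v : E3} (hv : v ≠ 0) : fromSphere α β γ v ≠ 0 := by
  intro h
  have := ellipsoidForm_fromSphere hα hβ hγ v
  rw [h] at this
  exact hv (by simpa [ellipsoidForm, eq_comm (a := (0 : ℝ))] using this)

end FromSphere

section Chart

variable {α β γ k l : ℝ} (hαβ : α > β) (hβγ : β > γ) (hγ : γ > 0)
  (hkl : k ^ 2 + l ^ 2 = 1) (hk : 0 < k) (hl : 0 < l) (hβ : β = α * l ^ 2 + γ * k ^ 2)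
include hαβ hβγ hγ hkl hk hl hβ

-- Given `hkl`, the relation `hβ` says `k² = (α - β) / (α - γ)` and `l² = (β - γ) / (α - γ)`.
omit hk hl in
theorem isUmbilicPoint_fromSphere_iff (v : E3) :
    IsUmbilicPoint α β γ (fromSphere α β γ v) ↔ v 1 = 0 ∧ v 0 ^ 2 = k ^ 2 ∧ v 2 ^ 2 = l ^ 2 := by
  have hβ0 : 0 < β := hγ.trans hβγ
  have hα : 0 < α := hβ0.trans hαβ
  have hd : α - γ ≠ 0 := by linarith
  have h1 : α * (α - β) / (α - γ) = α * k ^ 2 := by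
    rw [div_eq_iff hd]
    linear_combination -α * hβ - α ^ 2 * hkl
  have h2 : γ * (β - γ) / (α - γ) = γ * l ^ 2 := by
    rw [div_eq_iff hd]
    linear_combination γ * hβ + γ ^ 2 * hkl
  simp only [IsUmbilicPoint, h1, h2, fromSphere, diagMap_apply_zero, diagMap_apply_one,
    diagMap_apply_two, mul_pow, Real.sq_sqrt hα.le, Real.sq_sqrt hγ.le, mul_eq_zero,
    (Real.sqrt_pos.2 hβ0).ne', false_or, mul_right_inj' hα.ne', mul_right_inj' hγ.ne']

theorem fromSphere_sphereParam_mem_iff (θ φ : ℝ) :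
    fromSphere α β γ (sphereParam k l θ φ) ∈ regularPart (ellipsoidForm α β γ) ↔
      ¬(Real.sin θ = 0 ∧ Real.sin φ = 0) := by
  have hβ0 : 0 < β := hγ.trans hβγ
  have hα : 0 < α := hβ0.trans hαβ
  rw [regularPart, Set.mem_sdiff, mem_umbilics_iff hαβ hβγ hγ,
    isUmbilicPoint_fromSphere_iff hαβ hβγ hγ hkl hβ, sphereParam_umbilic_iff hkl hk hl,
    mem_ofPred_eq, ellipsoidForm_fromSphere hα hβ0 hγ, sphereParam_norm_sq hkl hk hl]
  simp

omit hβ in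
theorem exists_fromSphere_sphereParam_eq {p : E3} (hp : ellipsoidForm α β γ p = 1) :
    ∃ θ φ, fromSphere α β γ (sphereParam k l θ φ) = p := by
  have hβ0 : 0 < β := hγ.trans hβγ
  have hα : 0 < α := hβ0.trans hαβ
  obtain ⟨v, rfl⟩ := exists_fromSphere_eq hα hβ0 hγ p
  rw [ellipsoidForm_fromSphere hα hβ0 hγ] at hp
  obtain ⟨θ, φ, rfl⟩ := exists_sphereParam_eq hkl hk hl hp
  exact ⟨θ, φ, rfl⟩

omit hk hl hβ in
theorem angleCoord_sphereParam (θ φ : ℝ) :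
    angleCoord α β γ k l 1 (fromSphere α β γ (sphereParam k l θ φ)) =
      Real.arcsin (k * Real.cos θ) ∧
    angleCoord α β γ k l (-1) (fromSphere α β γ (sphereParam k l θ φ)) =
      Real.arcsin (l * Real.cos φ) := by
  have hβ0 : 0 < β := hγ.trans hβγ
  have hα : 0 < α := hβ0.trans hαβ
  obtain ⟨h1, h2⟩ := arcsin_sphereParam hkl θ φ
  simp only [angleCoord, inner_conormal_fromSphere hα hβ0 hγ, E3.inner_eq (!₂[k, 0, l]),
    E3.inner_eq (!₂[k, 0, -l]), Matrix.cons_val_zero, Matrix.cons_val_one,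
    Matrix.cons_val, zero_mul, add_zero, neg_mul, ← sub_eq_add_neg, h1, h2]
  constructor <;> ring

omit hk hl in
theorem isUmbilicPoint_focus :
    IsUmbilicPoint α β γ (fromSphere α β γ !₂[k, 0, l]) ∧
      IsUmbilicPoint α β γ (fromSphere α β γ !₂[k, 0, -l]) := by
  constructor <;> simp [isUmbilicPoint_fromSphere_iff hαβ hβγ hγ hkl hβ]

omit hk hl in
theorem regularPart_subset_angleDomain :
    regularPart (ellipsoidForm α β γ) ⊆ angleDomain α β γ k l := by
  intro p hp
  obtain ⟨h1, h2⟩ := isUmbilicPoint_focus hαβ hβγ hγ hkl hβ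
  exact ⟨sq_lt_one_iff_abs_lt_one _ |>.1 (h1.inner_sq_lt hαβ hβγ hγ hp),
    sq_lt_one_iff_abs_lt_one _ |>.1 (h2.inner_sq_lt hαβ hβγ hγ hp)⟩

/-- The ratio `F / ‖·‖²` equals `1 / (γ sin² φ + β cos² φ)` in the `φ` direction and `1 / (α sin² θ
+ β cos² θ)` in the `θ` direction. The first is larger, so the curves `θ = const` belong to the
larger curvature. -/
theorem principal_sphereParam_iff {θ φ : ℝ}
    (hS : fromSphere α β γ (sphereParam k l θ φ) ∈ regularPart (ellipsoidForm α β γ)) (v : E3) :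
    (IsMaxPrincipal (ellipsoidForm α β γ) (fromSphere α β γ (sphereParam k l θ φ)) v ↔
      ∃ t : ℝ, t ≠ 0 ∧ v = t • fromSphere α β γ (sphereParamRight k l θ φ)) ∧
    (IsMinPrincipal (ellipsoidForm α β γ) (fromSphere α β γ (sphereParam k l θ φ)) v ↔
      ∃ t : ℝ, t ≠ 0 ∧ v = t • fromSphere α β γ (sphereParamLeft k l θ φ)) := by
  have hβ0 : 0 < β := hγ.trans hβγ
  have hα : 0 < α := hβ0.trans hαβ
  have hns := (fromSphere_sphereParam_mem_iff hαβ hβγ hγ hkl hk hl hβ θ φ).1 hS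
  have hθ := Real.sin_sq_add_cos_sq θ
  have hφ := Real.sin_sq_add_cos_sq φ
  have hpos : ∀ {c d : ℝ}, 0 < c → 0 < d → 0 < c * Real.sin θ ^ 2 + d * Real.sin φ ^ 2 := by
    intro c d hc hd
    rw [not_and_or] at hns
    rcases hns with h | h
    · exact add_pos_of_pos_of_nonneg (by positivity) (by positivity)
    · exact add_pos_of_nonneg_of_pos (by positivity) (by positivity)
  have hM := hpos (pow_pos hk 2) (pow_pos hl 2)
  have hμ : 0 < γ * Real.sin φ ^ 2 + β * Real.cos φ ^ 2 := by
    have : 0 ≤ (β - γ) * Real.cos φ ^ 2 := mul_nonneg (by linarith) (sq_nonneg _)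
    nlinarith
  -- The gap is `(α - β) sin² θ + (β - γ) sin² φ`, which vanishes only at the umbilics.
  have hμν : γ * Real.sin φ ^ 2 + β * Real.cos φ ^ 2 < α * Real.sin θ ^ 2 + β * Real.cos θ ^ 2 := by
    have := hpos (sub_pos.2 hαβ) (sub_pos.2 hβγ)
    rw [Real.cos_sq', Real.cos_sq']
    linarith
  have hν := hμ.trans hμν
  have hn₁ : sphereParamRight k l θ φ ≠ 0 := by
    intro h
    have h1 := norm_sq_sphereParamRight hkl hk hl θ φ
    rw [h, norm_zero] at h1
    linarith
  have hn₂ : sphereParamLeft k l θ φ ≠ 0 := by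
    intro h
    have h1 := norm_sq_sphereParamLeft hkl hk hl θ φ
    rw [h, norm_zero] at h1
    linarith
  refine principal_iff hS.1 (l₁ := 1 / (γ * Real.sin φ ^ 2 + β * Real.cos φ ^ 2))
    (l₂ := 1 / (α * Real.sin θ ^ 2 + β * Real.cos θ ^ 2)) ?_ ?_
    (fromSphere_ne_zero hα hβ0 hγ hn₁) (fromSphere_ne_zero hα hβ0 hγ hn₂) ?_ ?_ ?_ ?_
    (one_div_lt_one_div_of_lt hμ hμν) v
  · rw [mem_tangentSpace, inner_conormal_fromSphere hα hβ0 hγ,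
      inner_sphereParam_right hkl hk hl]
  · rw [mem_tangentSpace, inner_conormal_fromSphere hα hβ0 hγ,
      inner_sphereParam_left hkl hk hl]
  · rw [inner_fromSphere hα hβ0 hγ, weighted_inner_sphereParamRight_left hkl hk hl hβ]
  · rw [inner_conormal_fromSphere hα hβ0 hγ, inner_sphereParamRight_left hkl hk hl]
  · rw [ellipsoidForm_fromSphere hα hβ0 hγ, norm_sq_fromSphere hα hβ0 hγ,
      weighted_norm_sq_sphereParamRight hkl hk hl hβ, one_div, inv_mul_cancel_left₀ hμ.ne']
  · rw [ellipsoidForm_fromSphere hα hβ0 hγ, norm_sq_fromSphere hα hβ0 hγ,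
      weighted_norm_sq_sphereParamLeft hkl hk hl hβ, one_div, inv_mul_cancel_left₀ hν.ne']

/-- The lines of curvature for the larger principal curvature. -/
def maxChart : CurveChart (ellipsoidForm α β γ) (regularPart (ellipsoidForm α β γ))
    (IsMaxPrincipal (ellipsoidForm α β γ)) where
  Ψ θ φ := fromSphere α β γ (sphereParam k l θ φ)
  Ψθ θ φ := fromSphere α β γ (sphereParamLeft k l θ φ)
  Ψφ θ φ := fromSphere α β γ (sphereParamRight k l θ φ)
  k := k
  a := angleCoord α β γ k l 1
  -- With these parameters `sin (angleCoord) / l = cos φ`, so the denominator is `√β |sin φ|`, while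
  -- the middle coordinate is `√β sin θ sin φ`.
  g := edgeCoord α β γ k l (-1) l
  U := angleDomain α β γ k l
  V := edgeDomain α β γ k l (-1) l
  k_pos := hk
  k_lt_one := by nlinarith
  surj p hp := exists_fromSphere_sphereParam_eq hαβ hβγ hγ hkl hk hl hp.1
  mem_iff := fromSphere_sphereParam_mem_iff hαβ hβγ hγ hkl hk hl hβ
  congr_left θ θ' φ h1 h2 := by rw [sphereParam_congr_left φ h1 h2]
  congr_right θ φ φ' h1 h2 := by rw [sphereParam_congr_right θ h1 h2]
  neg_neg θ φ := by rw [sphereParam_neg_neg]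
  hasDerivAt_left θ φ := (fromSphere α β γ).hasFDerivAt.comp_hasDerivAt θ
    (hasDerivAt_sphereParam_left hkl hl θ φ)
  hasDerivAt_right θ φ := (fromSphere α β γ).hasFDerivAt.comp_hasDerivAt φ
    (hasDerivAt_sphereParam_right hkl hk θ φ)
  contDiff_right θ := (fromSphere α β γ).contDiff.comp (contDiff_sphereParam_right hkl hk θ)
  mem_tangentSpace θ φ _ := by
    have hβ0 : 0 < β := hγ.trans hβγ
    rw [_root_.mem_tangentSpace, inner_conormal_fromSphere (hβ0.trans hαβ) hβ0 hγ,
      inner_sphereParam_left hkl hk hl]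
  dir_iff θ φ hS v := (principal_sphereParam_iff hαβ hβγ hγ hkl hk hl hβ hS v).1
  a_eq θ φ := (angleCoord_sphereParam hαβ hβγ hγ hkl θ φ).1
  a_continuous := continuous_angleCoord 1
  U_open := isOpen_angleDomain
  U_subset := regularPart_subset_angleDomain hαβ hβγ hγ hkl hβ
  a_contDiffOn := contDiffOn_angleCoord 1
  V_open := isOpen_edgeDomain _ _
  mem_V_iff θ φ hS := by
    have h1 := abs_le.1 ((sq_le_one_iff_abs_le_one (l * Real.cos φ)).1
      (by linarith [one_sub_mul_cos_sq_pos (k := l) (by nlinarith) φ]))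
    rw [edgeDomain, mem_inter_iff, and_iff_right
      (regularPart_subset_angleDomain hαβ hβγ hγ hkl hβ hS), mem_ofPred_eq,
      (angleCoord_sphereParam hαβ hβγ hγ hkl θ φ).2, Real.sin_arcsin h1.1 h1.2,
      mul_div_cancel_left₀ _ hl.ne', Real.cos_sq', sub_lt_self_iff, sq_pos_iff]
  g_eq θ φ hφ := by
    have hβ0 : 0 < β := hγ.trans hβγ
    have h1 := abs_le.1 ((sq_le_one_iff_abs_le_one (l * Real.cos φ)).1
      (by linarith [one_sub_mul_cos_sq_pos (k := l) (by nlinarith) φ]))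
    rw [edgeCoord, (angleCoord_sphereParam hαβ hβγ hγ hkl θ φ).2,
      Real.sin_arcsin h1.1 h1.2, mul_div_cancel_left₀ _ hl.ne', ← Real.sin_sq, Real.sqrt_sq_eq_abs,
      fromSphere, diagMap_apply_one, mul_div_mul_left _ _ (Real.sqrt_pos.2 hβ0).ne', mul_div_assoc']
    rfl
  g_contDiffOn := contDiffOn_edgeCoord (hγ.trans hβγ) _ _

/-- The lines of curvature for the smaller principal curvature. -/
def minChart : CurveChart (ellipsoidForm α β γ) (regularPart (ellipsoidForm α β γ))
    (IsMinPrincipal (ellipsoidForm α β γ)) where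
  -- The two variables exchange roles, and with them `k` and `l`.
  Ψ φ θ := fromSphere α β γ (sphereParam k l θ φ)
  Ψθ φ θ := fromSphere α β γ (sphereParamRight k l θ φ)
  Ψφ φ θ := fromSphere α β γ (sphereParamLeft k l θ φ)
  k := l
  a := angleCoord α β γ k l (-1)
  g := edgeCoord α β γ k l 1 k
  U := angleDomain α β γ k l
  V := edgeDomain α β γ k l 1 k
  k_pos := hl
  k_lt_one := by nlinarith
  surj p hp := by
    obtain ⟨θ, φ, h⟩ := exists_fromSphere_sphereParam_eq hαβ hβγ hγ hkl hk hl hp.1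
    exact ⟨φ, θ, h⟩
  mem_iff φ θ := by
    rw [fromSphere_sphereParam_mem_iff hαβ hβγ hγ hkl hk hl hβ, and_comm]
  congr_left φ φ' θ h1 h2 := by rw [sphereParam_congr_right θ h1 h2]
  congr_right φ θ θ' h1 h2 := by rw [sphereParam_congr_left φ h1 h2]
  neg_neg φ θ := by rw [sphereParam_neg_neg]
  hasDerivAt_left φ θ := (fromSphere α β γ).hasFDerivAt.comp_hasDerivAt φ
    (hasDerivAt_sphereParam_right hkl hk θ φ)
  hasDerivAt_right φ θ := (fromSphere α β γ).hasFDerivAt.comp_hasDerivAt θ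
    (hasDerivAt_sphereParam_left hkl hl θ φ)
  contDiff_right φ := (fromSphere α β γ).contDiff.comp (contDiff_sphereParam_left hkl hl φ)
  mem_tangentSpace φ θ _ := by
    have hβ0 : 0 < β := hγ.trans hβγ
    rw [_root_.mem_tangentSpace, inner_conormal_fromSphere (hβ0.trans hαβ) hβ0 hγ,
      inner_sphereParam_right hkl hk hl]
  dir_iff φ θ hS v := (principal_sphereParam_iff hαβ hβγ hγ hkl hk hl hβ hS v).2
  a_eq φ θ := (angleCoord_sphereParam hαβ hβγ hγ hkl θ φ).2
  a_continuous := continuous_angleCoord (-1)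
  U_open := isOpen_angleDomain
  U_subset := regularPart_subset_angleDomain hαβ hβγ hγ hkl hβ
  a_contDiffOn := contDiffOn_angleCoord (-1)
  V_open := isOpen_edgeDomain _ _
  mem_V_iff φ θ hS := by
    have h1 := abs_le.1 ((sq_le_one_iff_abs_le_one (k * Real.cos θ)).1
      (by linarith [one_sub_mul_cos_sq_pos (k := k) (by nlinarith) θ]))
    rw [edgeDomain, mem_inter_iff, and_iff_right
      (regularPart_subset_angleDomain hαβ hβγ hγ hkl hβ hS), mem_ofPred_eq,
      (angleCoord_sphereParam hαβ hβγ hγ hkl θ φ).1, Real.sin_arcsin h1.1 h1.2,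
      mul_div_cancel_left₀ _ hk.ne', Real.cos_sq', sub_lt_self_iff, sq_pos_iff]
  g_eq φ θ hθ := by
    have hβ0 : 0 < β := hγ.trans hβγ
    have h1 := abs_le.1 ((sq_le_one_iff_abs_le_one (k * Real.cos θ)).1
      (by linarith [one_sub_mul_cos_sq_pos (k := k) (by nlinarith) θ]))
    rw [edgeCoord, (angleCoord_sphereParam hαβ hβγ hγ hkl θ φ).1,
      Real.sin_arcsin h1.1 h1.2, mul_div_cancel_left₀ _ hk.ne', ← Real.sin_sq, Real.sqrt_sq_eq_abs,
      fromSphere, diagMap_apply_one, mul_div_mul_left _ _ (Real.sqrt_pos.2 hβ0).ne', mul_div_assoc',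
      mul_comm (Real.sin φ)]
    rfl
  g_contDiffOn := contDiffOn_edgeCoord (hγ.trans hβγ) _ _

end Chart

/-! ### The net of circular cross sections -/

section Circles

variable {α β γ : ℝ} (hαβ : α > β) (hβγ : β > γ) (hγ : γ > 0)
include hαβ hβγ hγ

theorem exists_mem_circleFamily_iff {u : E3} (hu : IsUmbilicPoint α β γ u) {x y : E3} :
    (∃ C ∈ circleFamily (ellipsoidForm α β γ) u, x ∈ C ∧ y ∈ C) ↔
      x ∈ regularPart (ellipsoidForm α β γ) ∧ y ∈ regularPart (ellipsoidForm α β γ) ∧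
        ⟪conormal α β γ u, x⟫ = ⟪conormal α β γ u, y⟫ := by
  have hF := hu.ellipsoidForm hαβ hβγ hγ
  constructor
  · rintro ⟨_, ⟨P, hP, -, rfl⟩, ⟨⟨hx, hxP⟩, hxU⟩, ⟨⟨hy, hyP⟩, hyU⟩⟩
    obtain ⟨d, hd⟩ := (parallel_tangentPlane_iff hF).1 hP
    exact ⟨⟨hx, hxU⟩, ⟨hy, hyU⟩, by rw [(hd x).1 hxP, (hd y).1 hyP]⟩
  · rintro ⟨hx, hy, h⟩
    obtain ⟨P, hP⟩ := exists_plane hF ⟪conormal α β γ u, x⟫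
    exact ⟨_, ⟨P, (parallel_tangentPlane_iff hF).2 ⟨_, hP⟩,
      hu.cutsCircle hαβ hβγ hγ hP (hu.inner_sq_lt hαβ hβγ hγ hx), rfl⟩,
      ⟨⟨hx.1, (hP x).2 rfl⟩, hx.2⟩, ⟨⟨hy.1, (hP y).2 h.symm⟩, hy.2⟩⟩

theorem foliates_circleFamily {u : E3} (hu : IsUmbilicPoint α β γ u) :
    Foliates (ellipsoidForm α β γ) (regularPart (ellipsoidForm α β γ))
      (circleFamily (ellipsoidForm α β γ) u) := by
  have hβ : 0 < β := hγ.trans hβγ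
  have hF := hu.ellipsoidForm hαβ hβγ hγ
  refine ⟨?_, ?_, ?_⟩
  · rintro _ ⟨P, hP, hcut, rfl⟩
    refine ⟨?_, fun x hx => ⟨hx.1.1, hx.2⟩⟩
    obtain ⟨d, hd⟩ := (parallel_tangentPlane_iff hF).1 hP
    obtain ⟨-, c, hc, r, hr, hS⟩ := hcut
    have hv : (EuclideanSpace.single 1 1 : E3) ∈ P.direction := by
      rw [direction_of_mem_iff hF hd, mem_tangentSpace, inner_conormal]
      simp [hu.1]
    have hmem : ∀ s : ℝ, |s| = r → c + s • (EuclideanSpace.single 1 1 : E3) ∈ circleIn P c r := by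
      intro s hs
      refine ⟨?_, ?_⟩
      · rw [add_comm]
        exact AffineSubspace.vadd_mem_of_mem_direction (P.direction.smul_mem s hv) hc
      · rw [dist_eq_norm, add_sub_cancel_left, norm_smul, Real.norm_eq_abs, hs]
        simp
    rw [← hS] at hmem
    -- The middle axis is parallel to the plane, so `c ± r e₁` lie on the circle, with `e₁` the
    -- middle unit vector. Their middle coordinates differ, hence one of them is nonzero, and
    -- umbilics have middle coordinate zero.
    by_cases h0 : c 1 + r = 0
    · refine ⟨_, hmem (-r) (by rw [abs_neg, abs_of_pos hr]), fun h => ?_⟩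
      have := ((mem_umbilics_iff hαβ hβγ hγ).1 h).1
      simp at this
      linarith
    · refine ⟨_, hmem r (abs_of_pos hr), fun h => h0 ?_⟩
      simpa using ((mem_umbilics_iff hαβ hβγ hγ).1 h).1
  · intro p hp
    obtain ⟨C, hC, hpC, -⟩ := (exists_mem_circleFamily_iff hαβ hβγ hγ hu).2 ⟨hp, hp, rfl⟩
    refine ⟨C, ⟨hC, hpC⟩, ?_⟩
    rintro C' ⟨hC', hpC'⟩
    obtain ⟨P, hP, -, rfl⟩ := hC
    obtain ⟨P', hP', -, rfl⟩ := hC'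
    rw [(existsUnique_parallel_plane hαβ hβγ hγ hu p).unique ⟨hP', hpC'.1.2⟩ ⟨hP, hpC.1.2⟩]
  · intro p hp
    have hder : HasFDerivAt (fun x => ⟪conormal α β γ u, x⟫) (innerSL ℝ (conormal α β γ u)) p :=
      (innerSL ℝ (conormal α β γ u)).hasFDerivAt
    refine ⟨univ, fun x => ⟪conormal α β γ u, x⟫, isOpen_univ, mem_univ p,
      (contDiff_const.inner ℝ contDiff_id).contDiffOn, ?_,
      fun x hx y hy h => (exists_mem_circleFamily_iff hαβ hβγ hγ hu).2 ⟨hx.1, hy.1, h⟩,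
      fun x _ h => ((exists_mem_circleFamily_iff hαβ hβγ hγ hu).1 h).2.2⟩
    have hlt := hu.inner_sq_lt hαβ hβγ hγ hp
    -- This is the projection of `u` to the tangent space along `p`; its `L_u`-value is `1 - L_u(p)²
    -- > 0`.
    refine ⟨u - ⟪conormal α β γ u, p⟫ • p, ?_, ?_⟩
    · rw [mem_tangentSpace, inner_sub_right, inner_smul_right, ← ellipsoidForm_eq_inner,
        show ellipsoidForm α β γ p = 1 from hp.1, mul_one, inner_conormal_comm, sub_self]
    · rw [hder.fderiv, innerSL_apply_apply, inner_sub_right, inner_smul_right,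
        ← ellipsoidForm_eq_inner, hF]
      intro h
      linarith

end Circles

/-! ### Diagonality -/

section Diagonal

variable {α β γ k l : ℝ} (hαβ : α > β) (hβγ : β > γ) (hγ : γ > 0)
  (hkl : k ^ 2 + l ^ 2 = 1) (hk : 0 < k) (hl : 0 < l) (hβ : β = α * l ^ 2 + γ * k ^ 2)
include hαβ hβγ hγ hkl hk hl hβ

omit hk hl in
theorem IsUmbilicPoint.eq_focus {u : E3} (hu : IsUmbilicPoint α β γ u) :
    (u = fromSphere α β γ !₂[k, 0, l] ∨ u = -fromSphere α β γ !₂[k, 0, l]) ∨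
      (u = fromSphere α β γ !₂[k, 0, -l] ∨ u = -fromSphere α β γ !₂[k, 0, -l]) := by
  have hβ0 : 0 < β := hγ.trans hβγ
  obtain ⟨v, rfl⟩ := exists_fromSphere_eq (hβ0.trans hαβ) hβ0 hγ u
  obtain ⟨h1, h0, h2⟩ := (isUmbilicPoint_fromSphere_iff hαβ hβγ hγ hkl hβ v).1 hu
  simp only [← map_neg]
  rcases sq_eq_sq_iff_eq_or_eq_neg.1 h0 with h0 | h0 <;>
    rcases sq_eq_sq_iff_eq_or_eq_neg.1 h2 with h2 | h2
  · exact Or.inl (Or.inl (congrArg _ (E3.ext (by simp [h0]) (by simp [h1]) (by simp [h2]))))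
  · exact Or.inr (Or.inl (congrArg _ (E3.ext (by simp [h0]) (by simp [h1]) (by simp [h2]))))
  · exact Or.inr (Or.inr (congrArg _ (E3.ext (by simp [h0]) (by simp [h1]) (by simp [h2]))))
  · exact Or.inl (Or.inr (congrArg _ (E3.ext (by simp [h0]) (by simp [h1]) (by simp [h2]))))

omit hk hl in
theorem inner_focus_eq_iff {p q : E3} (hp : p ∈ regularPart (ellipsoidForm α β γ))
    (hq : q ∈ regularPart (ellipsoidForm α β γ)) :
    (⟪conormal α β γ (fromSphere α β γ !₂[k, 0, l]), p⟫ =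
        ⟪conormal α β γ (fromSphere α β γ !₂[k, 0, l]), q⟫ ↔
      angleCoord α β γ k l 1 p + angleCoord α β γ k l (-1) p =
        angleCoord α β γ k l 1 q + angleCoord α β γ k l (-1) q) ∧
    (⟪conormal α β γ (fromSphere α β γ !₂[k, 0, -l]), p⟫ =
        ⟪conormal α β γ (fromSphere α β γ !₂[k, 0, -l]), q⟫ ↔
      angleCoord α β γ k l 1 p - angleCoord α β γ k l (-1) p =
        angleCoord α β γ k l 1 q - angleCoord α β γ k l (-1) q) := by
  have hp' := regularPart_subset_angleDomain hαβ hβγ hγ hkl hβ hp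
  have hq' := regularPart_subset_angleDomain hαβ hβγ hγ hkl hβ hq
  obtain ⟨p1, p2⟩ := abs_lt.1 hp'.1
  obtain ⟨p3, p4⟩ := abs_lt.1 hp'.2
  obtain ⟨q1, q2⟩ := abs_lt.1 hq'.1
  obtain ⟨q3, q4⟩ := abs_lt.1 hq'.2
  rw [← Real.arcsin_inj p1.le p2.le q1.le q2.le, ← Real.arcsin_inj p3.le p4.le q3.le q4.le]
  simp only [angleCoord]
  constructor <;> constructor <;> intro h <;> linarith

omit hk hl in
/-- The level sets of the distances from the tangent planes at two umbilic points, in angular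
coordinates. -/
theorem inner_umbilic_eq_iff {u v : E3} (hu : IsUmbilicPoint α β γ u)
    (hv : IsUmbilicPoint α β γ v) (h1 : v ≠ u) (h2 : v ≠ -u) :
    ∃ σ : ℝ, (σ = 1 ∨ σ = -1) ∧ ∀ p ∈ regularPart (_root_.ellipsoidForm α β γ),
      ∀ q ∈ regularPart (_root_.ellipsoidForm α β γ),
      (⟪conormal α β γ u, p⟫ = ⟪conormal α β γ u, q⟫ ↔
        angleCoord α β γ k l 1 p + σ * angleCoord α β γ k l (-1) p =
          angleCoord α β γ k l 1 q + σ * angleCoord α β γ k l (-1) q) ∧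
      (⟪conormal α β γ v, p⟫ = ⟪conormal α β γ v, q⟫ ↔
        angleCoord α β γ k l 1 p - σ * angleCoord α β γ k l (-1) p =
          angleCoord α β γ k l 1 q - σ * angleCoord α β γ k l (-1) q) := by
  have hneg : ∀ {w z : E3}, (w = z ∨ w = -z) → ∀ p q : E3,
      (⟪conormal α β γ w, p⟫ = ⟪conormal α β γ w, q⟫ ↔
        ⟪conormal α β γ z, p⟫ = ⟪conormal α β γ z, q⟫) := by
    rintro w z (rfl | rfl) p q
    · rfl
    · rw [map_neg, inner_neg_left, inner_neg_left, neg_inj]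
  have hsame : ∀ {z : E3}, (u = z ∨ u = -z) → (v = z ∨ v = -z) → False := by
    rintro z (rfl | rfl) (rfl | rfl)
    · exact h1 rfl
    · exact h2 rfl
    · exact h2 (neg_neg _).symm
    · exact h1 rfl
  -- Passing from an umbilic to its opposite does not change the level sets, so only the pair
  -- matters; the sign `σ` records which of the two pairs contains `u`.
  rcases hu.eq_focus hαβ hβγ hγ hkl hβ with hu' | hu' <;>
    rcases hv.eq_focus hαβ hβγ hγ hkl hβ with hv' | hv'
  · exact (hsame hu' hv').elim
  · refine ⟨1, Or.inl rfl, fun p hp q hq => ?_⟩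
    rw [hneg hu' p q, hneg hv' p q]
    simpa only [one_mul] using inner_focus_eq_iff hαβ hβγ hγ hkl hβ hp hq
  · refine ⟨-1, Or.inr rfl, fun p hp q hq => ?_⟩
    rw [hneg hu' p q, hneg hv' p q]
    simpa only [neg_one_mul, sub_neg_eq_add, ← sub_eq_add_neg] using
      (inner_focus_eq_iff hαβ hβγ hγ hkl hβ hp hq).symm
  · exact (hsame hu' hv').elim

theorem exists_mem_maxLines_iff {x y : E3} :
    (∃ C ∈ (curvatureNet (ellipsoidForm α β γ)).1, x ∈ C ∧ y ∈ C) ↔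
      x ∈ regularPart (ellipsoidForm α β γ) ∧ y ∈ regularPart (ellipsoidForm α β γ) ∧
        angleCoord α β γ k l 1 x = angleCoord α β γ k l 1 y :=
  (maxChart hαβ hβγ hγ hkl hk hl hβ).exists_mem_iff

theorem exists_mem_minLines_iff {x y : E3} :
    (∃ C ∈ (curvatureNet (ellipsoidForm α β γ)).2, x ∈ C ∧ y ∈ C) ↔
      x ∈ regularPart (ellipsoidForm α β γ) ∧ y ∈ regularPart (ellipsoidForm α β γ) ∧
        angleCoord α β γ k l (-1) x = angleCoord α β γ k l (-1) y :=
  (minChart hαβ hβγ hγ hkl hk hl hβ).exists_mem_iff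

theorem isNet_curvatureNet :
    IsNet (ellipsoidForm α β γ) (regularPart (ellipsoidForm α β γ))
      (curvatureNet (ellipsoidForm α β γ)) :=
  ⟨(maxChart hαβ hβγ hγ hkl hk hl hβ).foliates, (minChart hαβ hβγ hγ hkl hk hl hβ).foliates⟩

/-- All four families are level sets of `A`, `B`, `A + σ B` and `A - σ B`, so `Joins` depends only
on the values of `A` and `B`. A rectangle in the `(A, B)` plane has one diagonal on `A + σ B =
const` exactly when the other lies on `A - σ B = const`, and the converse relation is the same
computation with the pairs exchanged. -/
theorem diagonal_circles_curvatureNet {u v : E3} (hu : IsUmbilicPoint α β γ u)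
    (hv : IsUmbilicPoint α β γ v) (h1 : v ≠ u) (h2 : v ≠ -u) :
    IsDiagonalTo (circleFamily (ellipsoidForm α β γ) u, circleFamily (ellipsoidForm α β γ) v)
        (curvatureNet (ellipsoidForm α β γ)) ∧
      IsDiagonalTo (curvatureNet (ellipsoidForm α β γ))
        (circleFamily (ellipsoidForm α β γ) u, circleFamily (ellipsoidForm α β γ) v) := by
  obtain ⟨σ, hσ, hlev⟩ := inner_umbilic_eq_iff hαβ hβγ hγ hkl hβ hu hv h1 h2
  have hmax := fun x y => exists_mem_maxLines_iff hαβ hβγ hγ hkl hk hl hβ (x := x) (y := y)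
  have hmin := fun x y => exists_mem_minLines_iff hαβ hβγ hγ hkl hk hl hβ (x := x) (y := y)
  have hcu := fun x y => exists_mem_circleFamily_iff hαβ hβγ hγ hu (x := x) (y := y)
  have hcv := fun x y => exists_mem_circleFamily_iff hαβ hβγ hγ hv (x := x) (y := y)
  have hJoins : ∀ (N : Set (Set E3) × Set (Set E3)) (x y : E3), Joins N x y ↔
      (∃ C ∈ N.1, x ∈ C ∧ y ∈ C) ∨ (∃ C ∈ N.2, x ∈ C ∧ y ∈ C) := by
    intro N x y
    simp only [Joins, mem_union, or_and_right, exists_or]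
  constructor
  · intro A hA A' hA' B hB B' hB' _ _ p hp q hq r hr s hs hpr
    obtain ⟨hpS, hsS, e1⟩ := (hmax p s).1 ⟨A, hA, hp.1, hs.1⟩
    obtain ⟨hqS, hrS, e2⟩ := (hmax q r).1 ⟨A', hA', hq.1, hr.1⟩
    obtain ⟨-, -, e3⟩ := (hmin p q).1 ⟨B, hB, hp.2, hq.2⟩
    obtain ⟨-, -, e4⟩ := (hmin r s).1 ⟨B', hB', hr.2, hs.2⟩
    rw [hJoins] at hpr ⊢
    rcases hpr with h | h
    · refine Or.inr ((hcv q s).2 ⟨hqS, hsS, ((hlev q hqS s hsS).2).2 ?_⟩)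
      have e5 := (hlev p hpS r hrS).1.1 ((hcu p r).1 h).2.2
      rw [e1, e3, ← e2, e4] at e5
      linarith
    · refine Or.inl ((hcu q s).2 ⟨hqS, hsS, ((hlev q hqS s hsS).1).2 ?_⟩)
      have e5 := (hlev p hpS r hrS).2.1 ((hcv p r).1 h).2.2
      rw [e1, e3, ← e2, e4] at e5
      linarith
  · intro A hA A' hA' B hB B' hB' _ _ p hp q hq r hr s hs hpr
    obtain ⟨hpS, hsS, e1⟩ := (hcu p s).1 ⟨A, hA, hp.1, hs.1⟩
    obtain ⟨hqS, hrS, e2⟩ := (hcu q r).1 ⟨A', hA', hq.1, hr.1⟩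
    obtain ⟨-, -, e3⟩ := (hcv p q).1 ⟨B, hB, hp.2, hq.2⟩
    obtain ⟨-, -, e4⟩ := (hcv r s).1 ⟨B', hB', hr.2, hs.2⟩
    rw [(hlev p hpS s hsS).1] at e1
    rw [(hlev q hqS r hrS).1] at e2
    rw [(hlev p hpS q hqS).2] at e3
    rw [(hlev r hrS s hsS).2] at e4
    rw [hJoins] at hpr ⊢
    rcases hpr with h | h
    · have e5 := ((hmax p r).1 h).2.2
      refine Or.inr ((hmin q s).2 ⟨hqS, hsS, ?_⟩)
      rcases hσ with rfl | rfl <;> linarith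
    · have e5 := ((hmin p r).1 h).2.2
      refine Or.inl ((hmax q s).2 ⟨hqS, hsS, ?_⟩)
      rcases hσ with rfl | rfl <;> linarith

end Diagonal

theorem exists_modulus {α β γ : ℝ} (hαβ : α > β) (hβγ : β > γ) :
    ∃ k l : ℝ, k ^ 2 + l ^ 2 = 1 ∧ 0 < k ∧ 0 < l ∧ β = α * l ^ 2 + γ * k ^ 2 := by
  have h1 : 0 < (α - β) / (α - γ) := div_pos (by linarith) (by linarith)
  have h2 : 0 < (β - γ) / (α - γ) := div_pos (by linarith) (by linarith)
  have h3 : α - γ ≠ 0 := by linarith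
  refine ⟨√((α - β) / (α - γ)), √((β - γ) / (α - γ)), ?_, Real.sqrt_pos.2 h1, Real.sqrt_pos.2 h2, ?_⟩
  · rw [Real.sq_sqrt h1.le, Real.sq_sqrt h2.le]
    field_simp
    ring
  · rw [Real.sq_sqrt h1.le, Real.sq_sqrt h2.le]
    field_simp
    ring

end

theorem mainTheorem9 (α β γ : ℝ) (hαβ : α > β) (hβγ : β > γ) (hγ : γ > 0) :
    -- the four umbilic points: two pairs of opposite points, with parallel tangent planes
    ((umbilics (ellipsoidForm α β γ)).ncard = 4 ∧
      (∀ u ∈ umbilics (ellipsoidForm α β γ), -u ∈ umbilics (ellipsoidForm α β γ) ∧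
        (tangentPlane (ellipsoidForm α β γ) u).Parallel
          (tangentPlane (ellipsoidForm α β γ) (-u))) ∧
      (∀ u ∈ umbilics (ellipsoidForm α β γ), ∀ v ∈ umbilics (ellipsoidForm α β γ),
        (tangentPlane (ellipsoidForm α β γ) u).Parallel (tangentPlane (ellipsoidForm α β γ) v) →
          v = u ∨ v = -u)) ∧
    -- (1) slicing into two families of circles
    ((∀ u ∈ umbilics (ellipsoidForm α β γ),
        (∀ x ∈ ellipsoid α β γ, ∃! P : AffineSubspace ℝ E3,
          P.Parallel (tangentPlane (ellipsoidForm α β γ) u) ∧ x ∈ P) ∧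
        (∀ P : AffineSubspace ℝ E3, P.Parallel (tangentPlane (ellipsoidForm α β γ) u) →
          (ellipsoid α β γ ∩ P).Nonempty →
          ∃ c ∈ P, ∃ r : ℝ, 0 ≤ r ∧ ellipsoid α β γ ∩ P = circleIn P c r ∧
            (r = 0 ↔ P = tangentPlane (ellipsoidForm α β γ) u ∨
              P = tangentPlane (ellipsoidForm α β γ) (-u)))) ∧
      (∀ P : AffineSubspace ℝ E3, CutsCircle (ellipsoid α β γ) P →
        ∃ u ∈ umbilics (ellipsoidForm α β γ),
          P.Parallel (tangentPlane (ellipsoidForm α β γ) u))) ∧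
    -- (2) the tangent planes along a circular cross section meet in exactly one point, on the line
    -- through opposite umbilics (its point at infinity if the plane passes through the centre)
    (∀ P : AffineSubspace ℝ E3, CutsCircle (ellipsoid α β γ) P →
      ∃ u ∈ umbilics (ellipsoidForm α β γ),
        P.Parallel (tangentPlane (ellipsoidForm α β γ) u) ∧
        ((0 : E3) ∉ P → ∃ q ∈ line[ℝ, u, -u],
          (⋂ x ∈ ellipsoid α β γ ∩ P, (tangentPlane (ellipsoidForm α β γ) x : Set E3)) = {q}) ∧
        ((0 : E3) ∈ P →
          (⨅ x ∈ ellipsoid α β γ ∩ P, (tangentPlane (ellipsoidForm α β γ) x).direction) =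
            (line[ℝ, u, -u]).direction)) ∧
    -- (3) circular cross sections and lines of curvature are mutually diagonal nets
    (IsNet (ellipsoidForm α β γ) (regularPart (ellipsoidForm α β γ))
        (curvatureNet (ellipsoidForm α β γ)) ∧
      ∀ u ∈ umbilics (ellipsoidForm α β γ), ∀ v ∈ umbilics (ellipsoidForm α β γ),
        v ≠ u → v ≠ -u →
        IsNet (ellipsoidForm α β γ) (regularPart (ellipsoidForm α β γ))
          (circleFamily (ellipsoidForm α β γ) u, circleFamily (ellipsoidForm α β γ) v) ∧
        IsDiagonalTo (circleFamily (ellipsoidForm α β γ) u, circleFamily (ellipsoidForm α β γ) v)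
          (curvatureNet (ellipsoidForm α β γ)) ∧
        IsDiagonalTo (curvatureNet (ellipsoidForm α β γ))
          (circleFamily (ellipsoidForm α β γ) u, circleFamily (ellipsoidForm α β γ) v)) ∧
    -- (4) the deformation through the scaled confocal ellipsoids, isometric on the circles
    (∃ Φ : ℝ → E3 →L[ℝ] E3,
      ContinuousOn Φ (Ioi (-γ)) ∧ Φ 0 = ContinuousLinearMap.id ℝ E3 ∧
      (∀ l ∈ Ioi (-γ),
        Φ l '' ellipsoid α β γ =
          Real.sqrt (β / (β + l)) • ellipsoid (α + l) (β + l) (γ + l) ∧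
        (∀ C ∈ circularSections (ellipsoid α β γ), ∀ x ∈ C, ∀ y ∈ C,
          dist (Φ l x) (Φ l y) = dist x y) ∧
        (fun C => Φ l '' C) '' circularSections (ellipsoid α β γ) =
          circularSections (Φ l '' ellipsoid α β γ)) ∧
      (∀ l ∈ Ioi (-γ), ∀ m ∈ Ioi (-γ), ∃ k : ℝ, 0 < k ∧
        AreConfocal (Φ l '' ellipsoid α β γ) (k • (Φ m '' ellipsoid α β γ)))) := by
  have hU := fun p => mem_umbilics_iff hαβ hβγ hγ (p := p)
  refine ⟨⟨ncard_umbilics hαβ hβγ hγ, fun u hu => umbilics_neg_and_parallel hαβ hβγ hγ hu,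
    fun u hu v hv h => ((hU u).1 hu).eq_or_eq_neg_of_parallel hαβ hβγ hγ ((hU v).1 hv) h⟩,
    ⟨fun u hu => ⟨fun x _ => existsUnique_parallel_plane hαβ hβγ hγ ((hU u).1 hu) x,
      fun P hP hne => parallel_plane_inter hαβ hβγ hγ ((hU u).1 hu) hP hne⟩, fun P hP => ?_⟩,
    fun P hP => exists_common_point_tangentPlanes hαβ hβγ hγ hP, ?_,
    exists_deformation hαβ hβγ hγ⟩
  · obtain ⟨u, d, hu, -, hd⟩ := hP.exists_umbilic hαβ hβγ hγ
    exact ⟨u, (hU u).2 hu,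
      (parallel_tangentPlane_iff (hu.ellipsoidForm hαβ hβγ hγ)).2 ⟨d, hd⟩⟩
  · obtain ⟨k, l, hkl, hk, hl, hβ⟩ := exists_modulus hαβ hβγ
    refine ⟨isNet_curvatureNet hαβ hβγ hγ hkl hk hl hβ, fun u hu v hv h1 h2 => ?_⟩
    rw [hU] at hu hv
    exact ⟨⟨foliates_circleFamily hαβ hβγ hγ hu, foliates_circleFamily hαβ hβγ hγ hv⟩,
      diagonal_circles_curvatureNet hαβ hβγ hγ hkl hk hl hβ hu hv h1 h2⟩
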